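/- Let $d\ge 1$ be an integer and $\lambda>0$. For each integer $n\ge 1$ let $(X^{(n)}_j)_{j\in\mathbb{Z}^d}$ be a random field (a family of random variables on a probability space that may depend on $n$) with values in $\{0,1\}$. Assume that for every $n$ the field is weakly stationary, i.e. $\mathsf{E}X^{(n)}_{j+k}=\mathsf{E}X^{(n)}_{j}$ and $\mathrm{cov}(X^{(n)}_{i+k},X^{(n)}_{j+k})=\mathrm{cov}(X^{(n)}_i,X^{(n)}_j)$ for all $i,j,k\in\mathbb{Z}^d$, and associated, i.e. for every finite set $S\subset\mathbb{Z}^d$ and all bounded, coordinatewise nondecreasing Borel functions $f,g:\mathbb{R}^S\to\mathbb{R}$, $$\mathrm{cov}\bigl(f((X^{(n)}_j)_{j\in S}),\,g((X^{(n)}_j)_{j\in S})\bigr)\ge 0 .$$ Assume also that, as $n\to\infty$, $$\mathsf{P}\{X^{(n)}_0=1\}=\frac{\lambda+o(1)}{n^d}\qquad\text{and}\qquad n^d\sum_{j\in\mathbb{Z}^d,\ j\ne 0}\mathrm{cov}(X^{(n)}_0,X^{(n)}_j)\to 0,$$ where the series converges for all sufficiently large $n$. Define random measures on $\mathbb{R}^d$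 by $$\mu_n(A)=\sum_{j\in\mathbb{Z}^d\cap nA}X^{(n)}_j,\qquad nA=\{nx:\ x\in A\},\quad A\subset\mathbb{R}^d\ \text{Borel}.$$ Equip the space of locally finite Borel measures on $\mathbb{R}^d$ with the vague topology, i.e. the topology generated by the sets $\{\nu:\ s<\int f\,d\nu<t\}$ with $s,t\in\mathbb{R}$ and $f:\mathbb{R}^d\to[0,\infty)$ continuous with bounded support, and with its Borel $\sigma$-algebra. Then, as $n\to\infty$, the random measures $\mu_n$ converge in distribution (that is, their laws on this space converge weakly) to the homogeneous Poisson point process on $\mathbb{R}^d$ with intensity $\lambda$, i.e. to the random measure $\mu$ for which $\mu(A)$ is Poisson distributed with parameter $\lambda|A|$ for every bounded Borel set $A$ of Lebesgue measure $|A|$, and $\mu(A_1),\dots,\mu(A_m)$ are independent for pairwise disjoint bounded Borel sets $A_1,\dots,A_m$. -/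

import Mathlib

open MeasureTheory ProbabilityTheory Filter Topology
open scoped NNReal ENNReal Pointwise

noncomputable section

/-- A family of real random variables is associated if for every finite subfamily and every pair
of bounded, coordinatewise nondecreasing (Borel) functions of it, the covariance is nonnegative. -/
def IsAssociated {Ω ι : Type*} [MeasurableSpace Ω] (X : ι → Ω → ℝ) (P : Measure Ω) : Prop :=
  ∀ (s : Finset ι) (f g : (s → ℝ) → ℝ), Measurable f → Measurable g → Monotone f → Monotone g →
    (∃ C, ∀ x, |f x| ≤ C) → (∃ C, ∀ x, |g x| ≤ C) →
    0 ≤ cov[fun ω => f (fun i => X i ω), fun ω => g (fun i => X i ω); P]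

/-- Weak (second order) stationarity of a random field on `ℤ^d`: the mean and the covariance
are invariant under shifts. -/
structure IsWeaklyStationary {Ω : Type*} [MeasurableSpace Ω] {d : ℕ}
    (X : (Fin d → ℤ) → Ω → ℝ) (P : Measure Ω) : Prop where
  memLp : ∀ j, MemLp (X j) 2 P
  mean : ∀ j k, ∫ ω, X (j + k) ω ∂P = ∫ ω, X j ω ∂P
  covariance : ∀ i j k, cov[X (i + k), X (j + k); P] = cov[X i, X j; P]

/-- Locally finite Borel measures on `ℝ^d`. -/
def LocFinMeasure (d : ℕ) : Type :=
  {ν : Measure (EuclideanSpace ℝ (Fin d)) // IsLocallyFiniteMeasure ν}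

/-- The vague topology, generated by the sets `{ν | s < ∫ f dν < t}` with `f` nonnegative,
continuous and of bounded (equivalently, in `ℝ^d`, relatively compact) support. -/
instance LocFinMeasure.instTopologicalSpace (d : ℕ) : TopologicalSpace (LocFinMeasure d) :=
  TopologicalSpace.generateFrom
    {U | ∃ (f : EuclideanSpace ℝ (Fin d) → ℝ) (s t : ℝ), Continuous f ∧ HasCompactSupport f ∧
      (∀ x, 0 ≤ f x) ∧ U = {ν | s < ∫ x, f x ∂ν.1 ∧ ∫ x, f x ∂ν.1 < t}}

/-- The Borel σ-algebra of the vague topology. -/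
instance LocFinMeasure.instMeasurableSpace (d : ℕ) : MeasurableSpace (LocFinMeasure d) :=
  borel (LocFinMeasure d)

instance LocFinMeasure.instBorelSpace (d : ℕ) : BorelSpace (LocFinMeasure d) := ⟨rfl⟩

/-- The point of `ℤ^d`, seen in `ℝ^d`. -/
def latticePoint {d : ℕ} (j : Fin d → ℤ) : EuclideanSpace ℝ (Fin d) :=
  WithLp.toLp 2 (fun i => (j i : ℝ))

/-- The measure `∑ j, x j • δ_{j / n}` on `ℝ^d`. -/
def latticeMeasure {d : ℕ} (n : ℕ+) (x : (Fin d → ℤ) → ℝ) :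
    Measure (EuclideanSpace ℝ (Fin d)) :=
  Measure.sum fun j => ENNReal.ofReal (x j) • Measure.dirac ((n : ℝ)⁻¹ • latticePoint j)

/-- For nonnegative weights, the measure of a Borel set `A` is the sum of `x j` over the points
`j` of `ℤ^d` in `n A`. -/
theorem latticeMeasure_apply {d : ℕ} (n : ℕ+) (x : (Fin d → ℤ) → ℝ)
    {A : Set (EuclideanSpace ℝ (Fin d))} (hA : MeasurableSet A) :
    latticeMeasure n x A =
      ∑' j : {j : Fin d → ℤ // latticePoint j ∈ (n : ℝ) • A}, ENNReal.ofReal (x j) := by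
  have hn : (n : ℝ) ≠ 0 := by exact_mod_cast n.ne_zero
  rw [latticeMeasure, Measure.sum_apply _ hA]
  refine Eq.trans (tsum_congr fun j => ?_)
    (tsum_subtype {j : Fin d → ℤ | latticePoint j ∈ (n : ℝ) • A}
      (fun j => ENNReal.ofReal (x j))).symm
  by_cases h : (n : ℝ)⁻¹ • latticePoint j ∈ A
  · have h' : latticePoint j ∈ (n : ℝ) • A := (Set.mem_smul_set_iff_inv_smul_mem₀ hn _ _).2 h
    simp [Measure.dirac_apply' _ hA, h, h']
  · have h' : latticePoint j ∉ (n : ℝ) • A :=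
      fun h' => h ((Set.mem_smul_set_iff_inv_smul_mem₀ hn _ _).1 h')
    simp [Measure.dirac_apply' _ hA, h, h']

theorem latticeMeasure_isLocallyFinite {d : ℕ} (n : ℕ+) (x : (Fin d → ℤ) → ℝ) :
    IsLocallyFiniteMeasure (latticeMeasure n x) := by
  have hn : (0 : ℝ) < n := by exact_mod_cast n.pos
  refine ⟨fun a => ⟨Metric.ball a 1, Metric.ball_mem_nhds a one_pos, ?_⟩⟩
  rw [latticeMeasure_apply n x measurableSet_ball]
  have hfin : {j : Fin d → ℤ | latticePoint j ∈ (n : ℝ) • Metric.ball a 1}.Finite := by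
    refine (Set.finite_Icc (fun i => ⌊(n : ℝ) * (a i - 1)⌋) (fun i => ⌈(n : ℝ) * (a i + 1)⌉)).subset
      fun j hj => ?_
    obtain ⟨y, hy, hyj⟩ := hj
    have key : ∀ i, |y i - a i| < 1 ∧ (n : ℝ) * y i = j i := fun i => by
      constructor
      · have h1 := PiLp.norm_apply_le (y - a) i
        rw [Metric.mem_ball, dist_eq_norm] at hy
        simp only [PiLp.sub_apply, Real.norm_eq_abs] at h1
        linarith
      · have := congrArg (fun z : EuclideanSpace ℝ (Fin d) => z i) hyj
        simpa [latticePoint] using this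
    refine ⟨fun i => ?_, fun i => ?_⟩
    · obtain ⟨h1, h2⟩ := key i
      have h3 := (abs_lt.1 h1).1
      have h4 : (n : ℝ) * (a i - 1) ≤ j i := by rw [← h2]; gcongr; linarith
      exact Int.cast_le.1 ((Int.floor_le _).trans h4)
    · obtain ⟨h1, h2⟩ := key i
      have h3 := (abs_lt.1 h1).2
      have h4 : (j i : ℝ) ≤ (n : ℝ) * (a i + 1) := by rw [← h2]; gcongr; linarith
      exact Int.cast_le.1 (h4.trans (Int.le_ceil _))
  have : Fintype {j : Fin d → ℤ // latticePoint j ∈ (n : ℝ) • Metric.ball a 1} := hfin.fintype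
  rw [tsum_fintype]
  exact ENNReal.sum_lt_top.2 fun j _ => ENNReal.ofReal_lt_top

/-- The rescaled random measure `μ_n(A) = ∑_{j ∈ ℤ^d ∩ nA} X_j`. -/
def rescaledMeasure {Ω : Type*} {d : ℕ} (n : ℕ+) (X : (Fin d → ℤ) → Ω → ℝ) (ω : Ω) :
    LocFinMeasure d :=
  ⟨latticeMeasure n (fun j => X j ω), latticeMeasure_isLocallyFinite n _⟩

/-- `Q` is the law of the homogeneous Poisson point process on `ℝ^d` with intensity `lam`: the
mass of a bounded Borel set `A` has the Poisson distribution with parameter `lam * |A|`, and the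
masses of disjoint bounded Borel sets are independent. -/
structure IsPoissonProcessLaw {d : ℕ} (lam : ℝ≥0) (Q : Measure (LocFinMeasure d)) : Prop where
  hasLaw : ∀ A : Set (EuclideanSpace ℝ (Fin d)), MeasurableSet A → Bornology.IsBounded A →
    HasLaw (fun ν : LocFinMeasure d => ν.1 A)
      ((poissonMeasure (lam * (volume A).toNNReal)).map (fun k : ℕ => (k : ℝ≥0∞))) Q
  indep : ∀ (m : ℕ) (A : Fin m → Set (EuclideanSpace ℝ (Fin d))),
    (∀ i, MeasurableSet (A i)) → (∀ i, Bornology.IsBounded (A i)) →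
    Pairwise (Function.onFun Disjoint A) →
    iIndepFun (fun (i : Fin m) (ν : LocFinMeasure d) => ν.1 (A i)) Q

end

/-! Weak convergence for the vague topology follows from convergence of the characteristic
functionals `E exp(i ∫ f dμ_n)`, with `f` continuous of compact support
(`LocFinMeasure.tendsto_of_tendsto_charFunctional`). For such `f` the integral is a finite linear
combination of the `X_j`, with coefficients `f (j / n)`.

Association makes covariances control dependence. By Newman's inequality
(`IsAssociated.norm_charFun_sub_prod_le`) the joint characteristic function differs from the product
of the marginal ones by at most a weighted sum of the pairwise covariances. The support of `f` meets
`O(n^d)` lattice points, and by stationarity each contributes at most the full series `σ_n`, so the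
error is `O(n^d σ_n)` and tends to zero.

With `p_n = P{X_0 = 1}`, the product of the factors `1 + p_n (exp(i f(j/n)) - 1)` is within `O(n^d
p_n^2)` of the exponential of `p_n ∑ (exp(i f(j/n)) - 1)` (`norm_prod_sub_exp_le`). As `n^d p_n →
λ`, this exponent is asymptotically `λ` times a Riemann sum, and the limit is `exp(λ ∫ (exp(i f) -
1))`.

This is the characteristic functional of the process built from a Poisson number of uniform points
in each unit cube. The same formula for step functions gives the law and the independence of its
masses. -/

/-! ### Association and Newman's inequality -/

section Association

variable {Ω ι : Type*} [MeasurableSpace Ω] {P : Measure Ω} [IsProbabilityMeasure P]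
  {X : ι → Ω → ℝ}

theorem memLp_two_of_abs_le {f : Ω → ℝ} (hf : Measurable f) {C : ℝ} (h : ∀ ω, |f ω| ≤ C) :
    MemLp f 2 P :=
  MemLp.of_bound hf.aestronglyMeasurable C (Eventually.of_forall h)

theorem abs_le_one_of_zero_one {x : ℝ} (h : x = 0 ∨ x = 1) : |x| ≤ 1 := by
  rcases h with h | h <;> simp [h]

/-- For associated indicators, the covariance of a bounded `1`-Lipschitz function of a linear
combination with one of the indicators is controlled by the pairwise covariances. -/
theorem IsAssociated.abs_cov_lipschitz_le (hassoc : IsAssociated X P)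
    (hmeas : ∀ j, Measurable (X j)) (hval : ∀ j ω, X j ω = 0 ∨ X j ω = 1)
    (s : Finset ι) (k : ι) (t : ι → ℝ) {φ : ℝ → ℝ} (hφ : ∀ x y, |φ x - φ y| ≤ |x - y|)
    (hφb : ∀ x, |φ x| ≤ 1) (hφm : Measurable φ) :
    |cov[fun ω => φ (∑ j ∈ s, t j * X j ω), X k; P]| ≤
      ∑ j ∈ s, |t j| * cov[X j, X k; P] := by
  classical
  -- Association only admits test functions bounded on the whole space. Clamping to `[0, 1]`
  -- provides this and does not change the values `0` and `1`.
  let c : ℝ → ℝ := fun x => max 0 (min 1 x)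
  have hc : ∀ j ω, c (X j ω) = X j ω := fun j ω => by
    rcases hval j ω with h | h <;> simp [c, h]
  have hcm : Monotone c := fun x y h => max_le_max le_rfl (min_le_min le_rfl h)
  have hcmeas : Measurable c := by fun_prop
  have hc0 : ∀ x, 0 ≤ c x := fun x => le_max_left _ _
  have hc1 : ∀ x, c x ≤ 1 := fun x => max_le zero_le_one (min_le_left _ _)
  let S := insert k s
  let i : s → S := fun j => ⟨j, Finset.mem_insert_of_mem j.2⟩
  -- Since `φ` is `1`-Lipschitz, adding `∑ |t j| x j` to `± φ (∑ t j x j)` yields a coordinatewise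
  -- nondecreasing function. The two signs give the two halves of the absolute value bound.
  have hbase : ∀ e : ℝ, |e| = 1 →
      0 ≤ (∑ j ∈ s, |t j| * cov[X j, X k; P]) +
        e * cov[fun ω => φ (∑ j ∈ s, t j * X j ω), X k; P] := by
    intro e he
    let f : (S → ℝ) → ℝ := fun x =>
      (∑ j ∈ s.attach, |t j| * c (x (i j))) + e * φ (∑ j ∈ s.attach, t j * c (x (i j)))
    let g : (S → ℝ) → ℝ := fun x => c (x ⟨k, Finset.mem_insert_self _ _⟩)
    have hfm : Measurable f := by fun_prop
    have hgm : Measurable g := by fun_prop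
    have hf : Monotone f := by
      intro x y hxy
      have h1 : |φ (∑ j ∈ s.attach, t j * c (x (i j))) - φ (∑ j ∈ s.attach, t j * c (y (i j)))|
          ≤ ∑ j ∈ s.attach, |t j| * (c (y (i j)) - c (x (i j))) := by
        refine (hφ _ _).trans ?_
        rw [← Finset.sum_sub_distrib]
        refine (Finset.abs_sum_le_sum_abs _ _).trans (Finset.sum_le_sum fun j _ => ?_)
        rw [← mul_sub, abs_mul, abs_sub_comm, abs_of_nonneg (sub_nonneg.2 (hcm (hxy _)))]
      have h2 : e * (φ (∑ j ∈ s.attach, t j * c (x (i j))) -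
          φ (∑ j ∈ s.attach, t j * c (y (i j)))) ≤
          ∑ j ∈ s.attach, |t j| * (c (y (i j)) - c (x (i j))) := by
        refine (le_abs_self _).trans ?_
        rwa [abs_mul, he, one_mul]
      simp only [mul_sub, Finset.sum_sub_distrib] at h2
      simp only [f]
      linarith
    have hg : Monotone g := fun x y hxy => hcm (hxy _)
    have hfb : ∃ C, ∀ x, |f x| ≤ C := by
      refine ⟨(∑ j ∈ s.attach, |t j|) + 1, fun x => (abs_add_le _ _).trans (add_le_add ?_ ?_)⟩
      · refine (Finset.abs_sum_le_sum_abs _ _).trans (Finset.sum_le_sum fun j _ => ?_)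
        rw [abs_mul, abs_abs, abs_of_nonneg (hc0 _)]
        exact mul_le_of_le_one_right (abs_nonneg _) (hc1 _)
      · rw [abs_mul, he, one_mul]; exact hφb _
    have hgb : ∃ C, ∀ x, |g x| ≤ C :=
      ⟨1, fun x => by simp only [g]; rw [abs_of_nonneg (hc0 _)]; exact hc1 _⟩
    have key := hassoc S f g hfm hgm hf hg hfb hgb
    have e1 : (fun ω => f fun j => X j ω) =
        (fun ω => ∑ j ∈ s, |t j| * X j ω) + fun ω => e * φ (∑ j ∈ s, t j * X j ω) := by
      funext ω
      simp only [f, i, hc, Pi.add_apply]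
      rw [Finset.sum_attach s (fun j => |t j| * X j ω), Finset.sum_attach s (fun j => t j * X j ω)]
    have e2 : (fun ω => g fun j => X j ω) = X k := by funext ω; simp only [g, hc]
    have hXL : ∀ j, MemLp (X j) 2 P := fun j =>
      memLp_two_of_abs_le (hmeas j) fun ω => abs_le_one_of_zero_one (hval j ω)
    have hφL : MemLp (fun ω => φ (∑ j ∈ s, t j * X j ω)) 2 P :=
      memLp_two_of_abs_le (by fun_prop) fun ω => hφb _
    rw [e1, e2, covariance_add_left (memLp_finsetSum s fun j _ => (hXL j).const_mul _)
      (hφL.const_mul e) (hXL k), covariance_const_mul_left,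
      covariance_fun_sum_left' (fun j _ => (hXL j).const_mul _) (hXL k)] at key
    simpa only [covariance_const_mul_left] using key
  have h1 := hbase 1 (by simp)
  have h2 := hbase (-1) (by simp)
  exact abs_le.2 ⟨by linarith, by linarith⟩

theorem IsAssociated.cov_nonneg (hassoc : IsAssociated X P)
    (hmeas : ∀ j, Measurable (X j)) (hval : ∀ j ω, X j ω = 0 ∨ X j ω = 1) (j k : ι) :
    0 ≤ cov[X j, X k; P] := by
  have h := hassoc.abs_cov_lipschitz_le hmeas hval {j} k (fun _ => 1) (φ := fun _ => 0)
    (by simp) (by simp) measurable_const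
  simpa using (abs_nonneg _).trans h

/-- The number is the convex combination `(1 - p) + p z` of two points of the unit disc; for `z =
exp(i t)` it is the characteristic function of a Bernoulli variable. -/
theorem norm_one_add_mul_sub_one_le {p : ℝ} (h0 : 0 ≤ p) (h1 : p ≤ 1) {z : ℂ} (hz : ‖z‖ ≤ 1) :
    ‖1 + (p : ℂ) * (z - 1)‖ ≤ 1 := by
  have : 1 + (p : ℂ) * (z - 1) = ((1 - p : ℝ) : ℂ) + (p : ℂ) * z := by push_cast; ring
  rw [this]
  refine (norm_add_le _ _).trans ?_
  rw [norm_mul, Complex.norm_real, Complex.norm_real, Real.norm_of_nonneg h0,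
    Real.norm_of_nonneg (sub_nonneg.2 h1)]
  nlinarith

/-- Newman's inequality for associated indicators: the joint characteristic function is close to
the product of the marginal ones. -/
theorem IsAssociated.norm_charFun_sub_prod_le (hassoc : IsAssociated X P) [DecidableEq ι]
    (hmeas : ∀ j, Measurable (X j)) (hval : ∀ j ω, X j ω = 0 ∨ X j ω = 1)
    (s : Finset ι) (t : ι → ℝ) :
    ‖(∫ ω, Complex.exp (Complex.I * (∑ j ∈ s, t j * X j ω : ℝ)) ∂P) -
      ∏ j ∈ s, (1 + ((∫ ω, X j ω ∂P : ℝ) : ℂ) * (Complex.exp (Complex.I * t j) - 1))‖ ≤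
      2 * ∑ k ∈ s, ∑ j ∈ s.erase k, |t k| * (|t j| * cov[X j, X k; P]) := by
  have hXL : ∀ j, MemLp (X j) 2 P := fun j =>
    memLp_two_of_abs_le (hmeas j) fun ω => abs_le_one_of_zero_one (hval j ω)
  have hnn := hassoc.cov_nonneg hmeas hval
  induction s using Finset.induction_on with
  | empty => simp
  | insert k s hk ih =>
    set A : Ω → ℝ := fun ω => ∑ j ∈ s, t j * X j ω with hA
    have hAm : Measurable A := by fun_prop
    set p : ℝ := ∫ ω, X k ω ∂P with hp
    set z : ℂ := Complex.exp (Complex.I * t k) with hz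
    have hz1 : ‖z‖ = 1 := by rw [hz, mul_comm, Complex.norm_exp_ofReal_mul_I]
    have hp0 : 0 ≤ p := integral_nonneg fun ω => by
      rcases hval k ω with h | h <;> simp [h]
    have hp1 : p ≤ 1 := by
      have := integral_mono (μ := P) ((hXL k).integrable (by norm_num)) (integrable_const (1 : ℝ))
        (fun ω => (le_abs_self _).trans (abs_le_one_of_zero_one (hval k ω)))
      simpa using this
    -- For `X k ∈ {0, 1}` the exponential `exp(i t X)` equals the affine function `1 + (z - 1) X`,
    -- so only the covariance of `exp(i A)` with `X k` itself is needed.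
    have hE : ∀ ω, Complex.exp (Complex.I * (∑ j ∈ insert k s, t j * X j ω : ℝ)) =
        Complex.exp (Complex.I * (A ω : ℝ)) +
          (z - 1) * (Complex.exp (Complex.I * (A ω : ℝ)) * (X k ω : ℂ)) := by
      intro ω
      rw [Finset.sum_insert hk]
      push_cast
      rw [mul_add, Complex.exp_add]
      rcases hval k ω with h | h <;> simp [h, hz, A] <;> ring
    have hexpm : Measurable fun ω => Complex.exp (Complex.I * (A ω : ℝ)) := by fun_prop
    have hexpn : ∀ ω, ‖Complex.exp (Complex.I * (A ω : ℝ))‖ ≤ 1 := fun ω => by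
      rw [mul_comm, Complex.norm_exp_ofReal_mul_I]
    have hi1 : Integrable (fun ω => Complex.exp (Complex.I * (A ω : ℝ))) P :=
      Integrable.of_bound hexpm.aestronglyMeasurable 1 (Eventually.of_forall hexpn)
    have hXm := hmeas k
    have hi2 : Integrable (fun ω => Complex.exp (Complex.I * (A ω : ℝ)) * (X k ω : ℂ)) P := by
      refine Integrable.of_bound (by fun_prop) 1 (Eventually.of_forall fun ω => ?_)
      rw [norm_mul, Complex.norm_real]
      exact mul_le_one₀ (hexpn ω) (norm_nonneg _) (abs_le_one_of_zero_one (hval k ω))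
    set V : ℂ := ∫ ω, Complex.exp (Complex.I * (A ω : ℝ)) ∂P with hV
    set W : ℂ := ∫ ω, Complex.exp (Complex.I * (A ω : ℝ)) * (X k ω : ℂ) ∂P with hW
    have hint : ∫ ω, Complex.exp (Complex.I * (∑ j ∈ insert k s, t j * X j ω : ℝ)) ∂P
        = V + (z - 1) * W := by
      simp_rw [hE]
      rw [integral_add hi1 (hi2.const_mul _), integral_const_mul]
    have hcosm : Measurable fun ω => Real.cos (A ω) := by fun_prop
    have hsinm : Measurable fun ω => Real.sin (A ω) := by fun_prop
    -- The factor `2` comes from treating the real part (cosine) and the imaginary part (sine)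
    -- separately.
    have hcov : ‖W - V * p‖ ≤ 2 * ∑ j ∈ s, |t j| * cov[X j, X k; P] := by
      have hre : (W - V * p).re = cov[fun ω => Real.cos (A ω), X k; P] := by
        rw [covariance_eq_sub (memLp_two_of_abs_le hcosm fun ω => Real.abs_cos_le_one _) (hXL k)]
        rw [Complex.sub_re, Complex.re_mul_ofReal]
        congr 1
        · rw [hW, ← RCLike.re_eq_complex_re, ← integral_re hi2]
          congr with ω
          simp [mul_comm Complex.I, Complex.exp_ofReal_mul_I_re]
        · rw [hV, ← RCLike.re_eq_complex_re, ← integral_re hi1]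
          congr with ω
          simp [mul_comm Complex.I, Complex.exp_ofReal_mul_I_re]
      have him : (W - V * p).im = cov[fun ω => Real.sin (A ω), X k; P] := by
        rw [covariance_eq_sub (memLp_two_of_abs_le hsinm fun ω => Real.abs_sin_le_one _) (hXL k)]
        rw [Complex.sub_im, Complex.im_mul_ofReal]
        congr 1
        · rw [hW, ← RCLike.im_eq_complex_im, ← integral_im hi2]
          congr with ω
          simp [mul_comm Complex.I, Complex.exp_ofReal_mul_I_im]
        · rw [hV, ← RCLike.im_eq_complex_im, ← integral_im hi1]
          congr with ω
          simp [mul_comm Complex.I, Complex.exp_ofReal_mul_I_im]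
      refine (Complex.norm_le_abs_re_add_abs_im _).trans ?_
      rw [hre, him, two_mul]
      refine add_le_add (hassoc.abs_cov_lipschitz_le hmeas hval s k t
          (fun x y => ?_) Real.abs_cos_le_one Real.measurable_cos)
        (hassoc.abs_cov_lipschitz_le hmeas hval s k t
          (fun x y => ?_) Real.abs_sin_le_one Real.measurable_sin)
      · exact Real.abs_cos_sub_cos_le x y
      · exact Real.abs_sin_sub_sin_le x y
    set R : ℂ := ∏ j ∈ s, (1 + ((∫ ω, X j ω ∂P : ℝ) : ℂ) * (Complex.exp (Complex.I * t j) - 1))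
    rw [hint, Finset.prod_insert hk, ← hp, ← hz]
    have hsplit : V + (z - 1) * W - (1 + (p : ℂ) * (z - 1)) * R =
        (z - 1) * (W - V * p) + (1 + (p : ℂ) * (z - 1)) * (V - R) := by ring
    rw [hsplit]
    -- The double sum counts each pair in both orders while the induction uses one; the surplus
    -- terms are nonnegative and are dropped.
    have hB : ∑ k' ∈ insert k s, ∑ j ∈ (insert k s).erase k', |t k'| * (|t j| * cov[X j, X k'; P])
        ≥ |t k| * (∑ j ∈ s, |t j| * cov[X j, X k; P]) +
          ∑ k' ∈ s, ∑ j ∈ s.erase k', |t k'| * (|t j| * cov[X j, X k'; P]) := by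
      rw [Finset.sum_insert hk, Finset.erase_insert hk, Finset.mul_sum]
      refine add_le_add le_rfl (Finset.sum_le_sum fun k' _ =>
        Finset.sum_le_sum_of_subset_of_nonneg ?_ fun j _ _ => ?_)
      · exact Finset.erase_subset_erase _ (Finset.subset_insert _ _)
      · have := hnn j k'; positivity
    have hz2 : ‖z - 1‖ ≤ |t k| := Real.norm_exp_I_mul_ofReal_sub_one_le
    calc ‖(z - 1) * (W - V * p) + (1 + (p : ℂ) * (z - 1)) * (V - R)‖
        ≤ ‖z - 1‖ * ‖W - V * p‖ + ‖1 + (p : ℂ) * (z - 1)‖ * ‖V - R‖ := by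
          refine (norm_add_le _ _).trans ?_
          rw [norm_mul, norm_mul]
      _ ≤ |t k| * (2 * ∑ j ∈ s, |t j| * cov[X j, X k; P]) +
          1 * (2 * ∑ k' ∈ s, ∑ j ∈ s.erase k', |t k'| * (|t j| * cov[X j, X k'; P])) := by
          gcongr
          exact norm_one_add_mul_sub_one_le hp0 hp1 hz1.le
      _ ≤ _ := by linarith

end Association

/-! ### The vague topology and its Borel σ-algebra -/

section VagueTopology

variable {d : ℕ}

instance LocFinMeasure.isLocallyFiniteMeasure (ν : LocFinMeasure d) :
    IsLocallyFiniteMeasure ν.1 := ν.2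

/-- There is a sequence of nonnegative test functions that is dense in a sense strong enough to
determine the vague topology. -/
theorem exists_dense_testFunctions (d : ℕ) :
    ∃ g : ℕ → EuclideanSpace ℝ (Fin d) → ℝ,
      (∀ n, Continuous (g n) ∧ HasCompactSupport (g n) ∧ ∀ x, 0 ≤ g n x) ∧
      ∀ f : EuclideanSpace ℝ (Fin d) → ℝ, Continuous f → HasCompactSupport f → (∀ x, 0 ≤ f x) →
        ∃ m, ∀ ε > 0, ∃ n, ∀ x, |f x - g n x| ≤ ε * g m x := by
  let E := EuclideanSpace ℝ (Fin d)
  let S : ℕ → Set C(E, ℝ) := fun R =>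
    {f | (∀ x, 0 ≤ f x) ∧ ∀ x ∉ Metric.closedBall (0 : E) R, f x = 0}
  have hD : ∀ R, ∃ D : Set (S R), D.Countable ∧ Dense D := fun R =>
    TopologicalSpace.exists_countable_dense _
  choose D hDc hDd using hD
  -- `χ R` is at least `1` on the ball of radius `R`. It turns a uniform error `ε` there into one
  -- dominated by `ε χ R`, which every locally finite measure integrates.
  let χ : ℕ → E → ℝ := fun R x => max 0 (R + 1 - ‖x‖)
  let T : Set (E → ℝ) := Set.range χ ∪ ⋃ R, (fun f : S R => (f.1 : E → ℝ)) '' D R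
  have hTc : T.Countable :=
    (Set.countable_range χ).union (Set.countable_iUnion fun R => (hDc R).image _)
  obtain ⟨g, hg⟩ := hTc.exists_eq_range ⟨χ 0, Or.inl ⟨0, rfl⟩⟩
  have hT : ∀ f ∈ T, Continuous f ∧ HasCompactSupport f ∧ ∀ x, 0 ≤ f x := by
    rintro f (⟨R, rfl⟩ | hf)
    · refine ⟨by fun_prop, ?_, fun x => le_max_left _ _⟩
      refine HasCompactSupport.intro (isCompact_closedBall (0 : E) (R + 1)) fun x hx => ?_
      rw [mem_closedBall_zero_iff, not_le] at hx
      exact max_eq_left (by linarith)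
    · obtain ⟨R, hR⟩ := Set.mem_iUnion.1 hf
      obtain ⟨h, -, rfl⟩ := hR
      exact ⟨h.1.continuous,
        HasCompactSupport.intro (isCompact_closedBall (0 : E) R) h.2.2, h.2.1⟩
  refine ⟨g, fun n => hT _ (hg ▸ Set.mem_range_self n), fun f hf hfc hf0 => ?_⟩
  obtain ⟨r, hr⟩ := hfc.isCompact.isBounded.subset_closedBall (0 : E)
  obtain ⟨R, hR⟩ := exists_nat_ge r
  have hfS : (⟨f, hf⟩ : C(E, ℝ)) ∈ S R := by
    refine ⟨hf0, fun x hx => ?_⟩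
    by_contra h
    exact hx (Metric.closedBall_subset_closedBall hR (hr (subset_tsupport f h)))
  obtain ⟨m, hm⟩ : χ R ∈ Set.range g := hg ▸ Or.inl ⟨R, rfl⟩
  refine ⟨m, fun ε hε => ?_⟩
  have hev : ∀ᶠ h : S R in 𝓝 ⟨_, hfS⟩, ∀ x ∈ Metric.closedBall (0 : E) R, dist (f x) (h.1 x) < ε :=
    Metric.tendstoUniformlyOn_iff.1 (ContinuousMap.tendsto_iff_forall_isCompact_tendstoUniformlyOn.1
      (continuous_subtype_val.tendsto (⟨_, hfS⟩ : S R)) _ (isCompact_closedBall _ _)) ε hε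
  obtain ⟨h, hh, hhD⟩ := (mem_closure_iff_nhds.1 (hDd R ⟨_, hfS⟩)) _ hev
  obtain ⟨n, hn⟩ : (h.1 : E → ℝ) ∈ Set.range g :=
    hg ▸ Or.inr (Set.mem_iUnion.2 ⟨R, h, hhD, rfl⟩)
  refine ⟨n, fun x => ?_⟩
  rw [hn, hm]
  by_cases hx : x ∈ Metric.closedBall (0 : E) R
  · have h1 := hh x hx
    rw [Real.dist_eq] at h1
    have h2 : 1 ≤ χ R x := le_max_of_le_right (by
      rw [mem_closedBall_zero_iff] at hx; linarith)
    nlinarith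
  · rw [h.2.2 x hx, show f x = 0 from hfS.2 x hx, sub_zero, abs_zero]
    exact mul_nonneg hε.le (le_max_left _ _)

theorem LocFinMeasure.continuous_integral {f : EuclideanSpace ℝ (Fin d) → ℝ} (hf : Continuous f)
    (hfc : HasCompactSupport f) (hf0 : ∀ x, 0 ≤ f x) :
    Continuous fun ν : LocFinMeasure d => ∫ x, f x ∂ν.1 := by
  refine continuous_def.2 fun U hU => ?_
  rw [isOpen_iff_forall_mem_open]
  intro ν hν
  obtain ⟨ε, hε, hb⟩ := Metric.isOpen_iff.1 hU _ hν
  refine ⟨{ν' | (∫ x, f x ∂ν.1) - ε < ∫ x, f x ∂ν'.1 ∧ ∫ x, f x ∂ν'.1 < (∫ x, f x ∂ν.1) + ε},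
    fun ν' h => hb ?_, ?_, ?_⟩
  · rw [Real.ball_eq_Ioo]; exact h
  · exact TopologicalSpace.isOpen_generateFrom_of_mem ⟨f, _, _, hf, hfc, hf0, rfl⟩
  · constructor <;> linarith

/-- The vague topology is induced by countably many test functions. -/
theorem LocFinMeasure.exists_isInducing (d : ℕ) :
    ∃ g : ℕ → EuclideanSpace ℝ (Fin d) → ℝ,
      (∀ n, Continuous (g n) ∧ HasCompactSupport (g n) ∧ ∀ x, 0 ≤ g n x) ∧
      IsInducing fun (ν : LocFinMeasure d) (n : ℕ) => ∫ x, g n x ∂ν.1 := by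
  obtain ⟨g, hg, hdense⟩ := exists_dense_testFunctions d
  refine ⟨g, hg, isInducing_iff_nhds.2 fun ν₀ => le_antisymm ?_ ?_⟩
  · exact (continuous_pi fun n =>
      LocFinMeasure.continuous_integral (hg n).1 (hg n).2.1 (hg n).2.2).continuousAt.le_comap
  · set l := comap (fun (ν : LocFinMeasure d) (n : ℕ) => ∫ x, g n x ∂ν.1)
      (𝓝 fun n => ∫ x, g n x ∂ν₀.1) with hl
    have hlg : ∀ n, Tendsto (fun ν : LocFinMeasure d => ∫ x, g n x ∂ν.1) l
        (𝓝 (∫ x, g n x ∂ν₀.1)) := fun n =>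
      (continuous_apply n).continuousAt.tendsto.comp (tendsto_comap (f := fun
        (ν : LocFinMeasure d) (n : ℕ) => ∫ x, g n x ∂ν.1) (x := 𝓝 fun n => ∫ x, g n x ∂ν₀.1))
    have hint : ∀ (f : EuclideanSpace ℝ (Fin d) → ℝ) (ν : LocFinMeasure d), Continuous f →
        HasCompactSupport f → Integrable f ν.1 := fun f ν h h' =>
      h.integrable_of_hasCompactSupport h'
    have key : ∀ f : EuclideanSpace ℝ (Fin d) → ℝ, Continuous f → HasCompactSupport f →
        (∀ x, 0 ≤ f x) → Tendsto (fun ν : LocFinMeasure d => ∫ x, f x ∂ν.1) l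
        (𝓝 (∫ x, f x ∂ν₀.1)) := by
      intro f hf hfc hf0
      obtain ⟨m, hm⟩ := hdense f hf hfc hf0
      rw [Metric.tendsto_nhds]
      intro ε hε
      -- Near `ν₀` the integral of the dominating function `g m` stays below `K`, so one `g n`
      -- approximates `f` within `ε / 3` under all these measures simultaneously.
      set K := (∫ x, g m x ∂ν₀.1) + 1 with hK
      have hK0 : 0 < K := by
        have : 0 ≤ ∫ x, g m x ∂ν₀.1 := integral_nonneg (hg m).2.2
        linarith
      obtain ⟨n, hn⟩ := hm (ε / (3 * K)) (by positivity)
      have happrox : ∀ ν : LocFinMeasure d, ∫ x, g m x ∂ν.1 < K →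
          |(∫ x, f x ∂ν.1) - ∫ x, g n x ∂ν.1| ≤ ε / 3 := by
        intro ν hν
        rw [← integral_sub (hint _ _ hf hfc) (hint _ _ (hg n).1 (hg n).2.1)]
        refine (abs_integral_le_integral_abs).trans ?_
        refine (integral_mono ((hint _ _ hf hfc).sub (hint _ _ (hg n).1 (hg n).2.1)).abs
          ((hint _ _ (hg m).1 (hg m).2.1).const_mul _) hn).trans ?_
        rw [integral_const_mul]
        refine (mul_le_mul_of_nonneg_left hν.le (by positivity)).trans (le_of_eq ?_)
        field_simp
      filter_upwards [(hlg m).eventually_lt_const (show _ < K by linarith),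
        Metric.tendsto_nhds.1 (hlg n) (ε / 3) (by positivity)] with ν h1 h2
      have h3 := happrox ν h1
      have h4 := happrox ν₀ (by linarith)
      rw [Real.dist_eq] at h2 ⊢
      rw [abs_le] at h3 h4
      rw [abs_lt] at h2 ⊢
      constructor <;> linarith [h2.1, h2.2, h3.1, h3.2, h4.1, h4.2]
    rw [show 𝓝 ν₀ = _ from TopologicalSpace.nhds_generateFrom]
    refine le_iInf₂ fun U hU => le_principal_iff.2 ?_
    obtain ⟨hν, f, s, t, hf, hfc, hf0, rfl⟩ := hU
    exact ((key f hf hfc hf0).eventually_const_lt hν.1).and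
      ((key f hf hfc hf0).eventually_lt_const hν.2)

/-- With a countable base, the defining subbasis generates the Borel σ-algebra;
`LocFinMeasure.measurable_of_integral` rests on this. -/
instance LocFinMeasure.secondCountableTopology : SecondCountableTopology (LocFinMeasure d) := by
  obtain ⟨g, -, hg⟩ := LocFinMeasure.exists_isInducing d
  exact hg.secondCountableTopology

theorem LocFinMeasure.measurable_of_integral {Ω : Type*} [MeasurableSpace Ω]
    {φ : Ω → LocFinMeasure d}
    (h : ∀ f : EuclideanSpace ℝ (Fin d) → ℝ, Continuous f → HasCompactSupport f → (∀ x, 0 ≤ f x) →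
      Measurable fun ω => ∫ x, f x ∂(φ ω).1) : Measurable φ := by
  rw [show LocFinMeasure.instMeasurableSpace d = _ from borel_eq_generateFrom_of_subbasis rfl]
  refine measurable_generateFrom ?_
  rintro U ⟨f, s, t, hf, hfc, hf0, rfl⟩
  exact h f hf hfc hf0 measurableSet_Ioo

theorem LocFinMeasure.measure_lt_top_of_isBounded (ν : LocFinMeasure d)
    {A : Set (EuclideanSpace ℝ (Fin d))} (hA : Bornology.IsBounded A) : ν.1 A < ∞ :=
  hA.measure_lt_top

/-- The indicator of `K` is the decreasing limit of continuous functions of compact support, so the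
mass of `K` is a pointwise limit of vaguely continuous functions. -/
theorem LocFinMeasure.measurable_apply_of_isCompact {K : Set (EuclideanSpace ℝ (Fin d))}
    (hK : IsCompact K) : Measurable fun ν : LocFinMeasure d => ν.1 K := by
  -- The empty set is separate because `Metric.infDist x ∅` is `0` by convention.
  rcases K.eq_empty_or_nonempty with rfl | hne
  · simp
  have hreal : Measurable fun ν : LocFinMeasure d => ν.1.real K := by
    let f : ℕ → EuclideanSpace ℝ (Fin d) → ℝ := fun n x => max 0 (1 - (n + 1) * Metric.infDist x K)
    have hfcont : ∀ n, Continuous (f n) := fun n =>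
      continuous_const.max (continuous_const.sub
        (continuous_const.mul (Metric.continuous_infDist_pt K)))
    have hf0 : ∀ n x, 0 ≤ f n x := fun n x => le_max_left _ _
    have hle : ∀ n x, f n x ≤ f 0 x := fun n x => by
      refine max_le_max le_rfl ?_
      have := Metric.infDist_nonneg (x := x) (s := K)
      have hn : (0 : ℝ) ≤ n := n.cast_nonneg
      push_cast
      nlinarith
    have hfc : ∀ n, HasCompactSupport (f n) := fun n => by
      refine HasCompactSupport.intro (K := Metric.cthickening 1 K) hK.cthickening fun x hx => ?_
      refine le_antisymm ((hle n x).trans ?_) (hf0 n x)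
      refine max_le le_rfl ?_
      by_contra hcon
      refine hx (Metric.thickening_subset_cthickening _ _ ?_)
      rw [Metric.mem_thickening_iff, ← Metric.infDist_lt_iff hne]
      push_cast at hcon
      linarith
    refine measurable_of_tendsto_metrizable (f := fun n (ν : LocFinMeasure d) => ∫ x, f n x ∂ν.1)
      (fun n => (LocFinMeasure.continuous_integral (hfcont n) (hfc n) (hf0 n)).measurable) ?_
    refine tendsto_pi_nhds.2 fun ν => ?_
    rw [← integral_indicator_one hK.measurableSet]
    refine tendsto_integral_of_dominated_convergence (f 0)
      (fun n => (hfcont n).aestronglyMeasurable)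
      ((hfcont 0).integrable_of_hasCompactSupport (hfc 0))
      (fun n => Eventually.of_forall fun x => ?_) (Eventually.of_forall fun x => ?_)
    · rw [Real.norm_of_nonneg (hf0 n x)]; exact hle n x
    · by_cases hx : x ∈ K
      · simp [f, hx, Metric.infDist_zero_of_mem hx]
      · have hpos := (hK.isClosed.notMem_iff_infDist_pos hne).1 hx
        obtain ⟨N, hN⟩ := exists_nat_gt (Metric.infDist x K)⁻¹
        refine tendsto_const_nhds.congr' ?_
        filter_upwards [eventually_ge_atTop N] with n hn
        rw [Set.indicator_of_notMem hx, eq_comm]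
        refine max_eq_left ?_
        have h1 : (N : ℝ) ≤ n := by exact_mod_cast hn
        have h2 : 1 < N * Metric.infDist x K := (inv_lt_iff_one_lt_mul₀ hpos).1 hN
        nlinarith
  convert hreal.ennreal_ofReal using 2 with ν
  exact (ENNReal.ofReal_toReal hK.measure_lt_top.ne).symm

/-- Closed sets form a generating π-system, and their traces on a ball are compact. Restricting to
balls supplies the finiteness required by the π-λ argument, and the radius then grows. -/
theorem LocFinMeasure.measurable_apply {A : Set (EuclideanSpace ℝ (Fin d))}
    (hA : MeasurableSet A) : Measurable fun ν : LocFinMeasure d => ν.1 A := by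
  let B : ℕ → Set (EuclideanSpace ℝ (Fin d)) := fun R => Metric.closedBall 0 R
  have hfin : ∀ (R : ℕ) (ν : LocFinMeasure d), IsFiniteMeasure (ν.1.restrict (B R)) := fun R ν =>
    ⟨by rw [Measure.restrict_apply_univ]; exact (isCompact_closedBall _ _).measure_lt_top⟩
  have hR : ∀ R : ℕ, Measurable fun ν : LocFinMeasure d => ν.1.restrict (B R) := by
    intro R
    refine Measurable.measure_of_isPiSystem (S := {s | IsClosed s}) ?_ isPiSystem_isClosed ?_ ?_
    · rw [← borel_eq_generateFrom_isClosed]; exact BorelSpace.measurable_eq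
    · intro s hs
      simp_rw [Measure.restrict_apply (show IsClosed s from hs).measurableSet]
      exact LocFinMeasure.measurable_apply_of_isCompact
        ((isCompact_closedBall _ _).inter_left hs)
    · simp_rw [Measure.restrict_apply_univ]
      exact LocFinMeasure.measurable_apply_of_isCompact (isCompact_closedBall _ _)
  have heq : ∀ ν : LocFinMeasure d, ν.1 A = ⨆ R : ℕ, ν.1.restrict (B R) A := by
    intro ν
    have hmono : Monotone fun R : ℕ => A ∩ B R := fun R R' h =>
      Set.inter_subset_inter_right _ (Metric.closedBall_subset_closedBall (by exact_mod_cast h))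
    simp_rw [Measure.restrict_apply hA]
    rw [← hmono.measure_iUnion, ← Set.inter_iUnion, Metric.iUnion_closedBall_nat, Set.inter_univ]
  simp_rw [heq]
  exact Measurable.iSup fun R => (Measure.measurable_coe hA).comp (hR R)

end VagueTopology

/-! ### Weak convergence from characteristic functionals -/

section WeakConvergence

variable {d : ℕ}

/-- An open subset of `ℕ → ℝ` is an increasing union of open cylinders. -/
theorem exists_open_cylinders {V : Set (ℕ → ℝ)} (hV : IsOpen V) :
    ∃ W : (N : ℕ) → Set (EuclideanSpace ℝ (Fin N)), (∀ N, IsOpen (W N)) ∧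
      Monotone (fun N => {a : ℕ → ℝ | WithLp.toLp 2 (fun i : Fin N => a i) ∈ W N}) ∧
      V = ⋃ N, {a : ℕ → ℝ | WithLp.toLp 2 (fun i : Fin N => a i) ∈ W N} := by
  let ρ : (N : ℕ) → (ℕ → ℝ) → EuclideanSpace ℝ (Fin N) :=
    fun N a => WithLp.toLp 2 (fun i : Fin N => a i)
  -- Taking the largest open base whose cylinder lies in `V` makes the cylinders increase with `N`
  -- automatically.
  refine ⟨fun N => ⋃₀ {W | IsOpen W ∧ ρ N ⁻¹' W ⊆ V}, fun N => isOpen_sUnion fun W h => h.1, ?_, ?_⟩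
  · rintro N N' h a ⟨W, ⟨hW, hWV⟩, ha⟩
    let r : EuclideanSpace ℝ (Fin N') → EuclideanSpace ℝ (Fin N) :=
      fun w => WithLp.toLp 2 (fun i : Fin N => w (Fin.castLE h i))
    have hr : Continuous r := by fun_prop
    exact ⟨r ⁻¹' W, ⟨hW.preimage hr, fun b hb => hWV hb⟩, ha⟩
  · ext a
    rw [Set.mem_iUnion]
    constructor
    · intro ha
      obtain ⟨I, u, hu, hI⟩ := isOpen_pi_iff.1 hV a ha
      have hlt : ∀ i : I, (i : ℕ) < I.sup id + 1 := fun i =>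
        Nat.lt_succ_of_le (Finset.le_sup (f := id) i.2)
      refine ⟨I.sup id + 1, ⋂ i : I, {w | w ⟨i, hlt i⟩ ∈ u i}, ⟨?_, ?_⟩, ?_⟩
      · refine isOpen_iInter_of_finite fun i => (hu i i.2).1.preimage (by fun_prop)
      · intro b hb
        exact hI fun i hi => Set.mem_iInter.1 hb ⟨i, hi⟩
      · exact Set.mem_iInter.2 fun i => (hu i i.2).2
    · rintro ⟨N, W, ⟨-, hWV⟩, ha⟩
      exact hWV ha

/-- Convergence of the characteristic functionals on continuous functions with compact support
implies weak convergence for the vague topology. -/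
theorem LocFinMeasure.tendsto_of_tendsto_charFunctional_nat
    {μ : ℕ → ProbabilityMeasure (LocFinMeasure d)} {μ₀ : ProbabilityMeasure (LocFinMeasure d)}
    (h : ∀ f : EuclideanSpace ℝ (Fin d) → ℝ, Continuous f → HasCompactSupport f →
      Tendsto (fun n => ∫ ν, Complex.exp (Complex.I * (∫ x, f x ∂ν.1 : ℝ))
        ∂(μ n : Measure (LocFinMeasure d))) atTop
        (𝓝 (∫ ν, Complex.exp (Complex.I * (∫ x, f x ∂ν.1 : ℝ))
          ∂(μ₀ : Measure (LocFinMeasure d))))) :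
    Tendsto μ atTop (𝓝 μ₀) := by
  obtain ⟨g, hg, hind⟩ := LocFinMeasure.exists_isInducing d
  let Ψ : (N : ℕ) → LocFinMeasure d → EuclideanSpace ℝ (Fin N) :=
    fun N ν => WithLp.toLp 2 (fun i : Fin N => ∫ x, g i x ∂ν.1)
  have hgc : ∀ i, Continuous fun ν : LocFinMeasure d => ∫ x, g i x ∂ν.1 := fun i =>
    LocFinMeasure.continuous_integral (hg i).1 (hg i).2.1 (hg i).2.2
  have hΨ : ∀ N, Continuous (Ψ N) := fun N => by
    have : Continuous fun (ν : LocFinMeasure d) (i : Fin N) => ∫ x, g i x ∂ν.1 :=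
      continuous_pi fun i => hgc i
    fun_prop
  -- The characteristic function of the vector of integrals of the `g i` at `t` is the
  -- characteristic functional at `∑ t i * g i`. This function may change sign, which is why the
  -- hypothesis covers signed `f`.
  have hchar : ∀ (N : ℕ) (P : ProbabilityMeasure (LocFinMeasure d))
      (t : EuclideanSpace ℝ (Fin N)),
      charFun (P.map (hΨ N).aemeasurable : Measure (EuclideanSpace ℝ (Fin N))) t =
        ∫ ν, Complex.exp (Complex.I * (∫ x, ∑ i, t i * g i x ∂ν.1 : ℝ))
          ∂(P : Measure (LocFinMeasure d)) := by
    intro N P t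
    rw [charFun_apply, ProbabilityMeasure.toMeasure_map, integral_map (hΨ N).aemeasurable
      (by fun_prop)]
    refine integral_congr_ae (Eventually.of_forall fun ν => ?_)
    have : inner ℝ (Ψ N ν) t = ∫ x, ∑ i, t i * g i x ∂ν.1 := by
      rw [integral_finsetSum _ fun (i : Fin N) _ => Integrable.const_mul
        ((hg i).1.integrable_of_hasCompactSupport (hg i).2.1) _]
      simp [Ψ, PiLp.inner_apply, integral_const_mul]
    simp only
    rw [this, mul_comm]
  have hconv : ∀ N, Tendsto (fun n => (μ n).map (hΨ N).aemeasurable) atTop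
      (𝓝 (μ₀.map (hΨ N).aemeasurable)) := by
    intro N
    refine ProbabilityMeasure.tendsto_of_tendsto_charFun fun t => ?_
    simp_rw [hchar]
    refine h _ (continuous_finsetSum _ fun i _ => continuous_const.mul (hg i).1) ?_
    refine HasCompactSupport.intro (K := ⋃ i : Fin N, tsupport (g i))
      (isCompact_iUnion fun i => (hg i).2.1.isCompact) fun x hx => ?_
    refine Finset.sum_eq_zero fun i _ => ?_
    rw [image_eq_zero_of_notMem_tsupport fun hi => hx (Set.mem_iUnion.2 ⟨i, hi⟩), mul_zero]
  -- By the portmanteau criterion, lower bounds for open sets suffice. These pass from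
  -- finite-dimensional cylinders to their increasing unions, so no separate tightness argument is
  -- needed.
  refine tendsto_of_forall_isOpen_le_liminf_nat' fun G hG => ?_
  obtain ⟨V, hV, rfl⟩ := hind.isOpen_iff.1 hG
  obtain ⟨W, hW, hmono, hVW⟩ := exists_open_cylinders hV
  have hpre : (fun (ν : LocFinMeasure d) (n : ℕ) => ∫ x, g n x ∂ν.1) ⁻¹' V =
      ⋃ N, Ψ N ⁻¹' W N := by
    rw [hVW, Set.preimage_iUnion]; rfl
  have hmono' : Monotone fun N => Ψ N ⁻¹' W N := fun N N' h =>
    Set.preimage_mono (f := fun (ν : LocFinMeasure d) (n : ℕ) => ∫ x, g n x ∂ν.1) (hmono h)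
  rw [hpre, hmono'.measure_iUnion]
  refine iSup_le fun N => ?_
  have h1 := ProbabilityMeasure.le_liminf_measure_open_of_tendsto (hconv N) (hW N)
  simp only [ProbabilityMeasure.toMeasure_map,
    Measure.map_apply (hΨ N).measurable (hW N).measurableSet] at h1
  refine h1.trans (liminf_le_liminf (Eventually.of_forall fun n => ?_))
  exact measure_mono (Set.subset_iUnion (fun N => Ψ N ⁻¹' W N) N)

theorem LocFinMeasure.tendsto_of_tendsto_charFunctional {ι : Type*} {L : Filter ι}
    [L.IsCountablyGenerated]
    {μ : ι → ProbabilityMeasure (LocFinMeasure d)} {μ₀ : ProbabilityMeasure (LocFinMeasure d)}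
    (h : ∀ f : EuclideanSpace ℝ (Fin d) → ℝ, Continuous f → HasCompactSupport f →
      Tendsto (fun n => ∫ ν, Complex.exp (Complex.I * (∫ x, f x ∂ν.1 : ℝ))
        ∂(μ n : Measure (LocFinMeasure d))) L
        (𝓝 (∫ ν, Complex.exp (Complex.I * (∫ x, f x ∂ν.1 : ℝ))
          ∂(μ₀ : Measure (LocFinMeasure d))))) :
    Tendsto μ L (𝓝 μ₀) :=
  tendsto_of_seq_tendsto fun _ hu =>
    LocFinMeasure.tendsto_of_tendsto_charFunctional_nat fun f hf hfc => (h f hf hfc).comp hu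

end WeakConvergence

/-! ### Construction of the Poisson process -/

noncomputable section PoissonConstruction

variable {d : ℕ}

/-- On `B` the infinite sum of measures is a finite one. This serves both the lattice measures and
the superposition of cubes. -/
theorem integral_measureSum_of_support {α ι F : Type*} [MeasurableSpace α] [NormedAddCommGroup F]
    [NormedSpace ℝ F] {m : ι → Measure α} {B : Set α} (hB : MeasurableSet B) (K : Finset ι)
    (hm : ∀ k ∉ K, m k B = 0) {f : α → F} (hf : ∀ x ∉ B, f x = 0)
    (hint : ∀ k ∈ K, Integrable f (m k)) :
    ∫ x, f x ∂(Measure.sum m) = ∑ k ∈ K, ∫ x, f x ∂(m k) := by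
  have h1 : (Measure.sum m).restrict B = ∑ k ∈ K, (m k).restrict B := by
    ext s hs
    rw [Measure.restrict_apply hs, Measure.sum_apply _ (hs.inter hB),
      tsum_eq_sum (s := K) fun k hk => measure_mono_null Set.inter_subset_right (hm k hk),
      Measure.finsetSum_apply]
    exact Finset.sum_congr rfl fun k _ => (Measure.restrict_apply hs).symm
  rw [← setIntegral_eq_integral_of_forall_compl_eq_zero hf, h1,
    integral_finsetSum_measure fun k hk => (hint k hk).restrict]
  exact Finset.sum_congr rfl fun k _ => setIntegral_eq_integral_of_forall_compl_eq_zero hf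

/-- The half-open unit cube with lower corner `k`. -/
def unitCube (k : Fin d → ℤ) : Set (EuclideanSpace ℝ (Fin d)) := {x | ∀ i, ⌊x i⌋ = k i}

theorem measurableSet_unitCube (k : Fin d → ℤ) : MeasurableSet (unitCube k) := by
  have : unitCube k = ⋂ i, (fun x : EuclideanSpace ℝ (Fin d) => ⌊x i⌋) ⁻¹' {k i} := by
    ext x; simp [unitCube]
  rw [this]
  exact MeasurableSet.iInter fun i => (Int.measurable_floor.comp (by fun_prop))
    (measurableSet_singleton _)

theorem volume_unitCube (k : Fin d → ℤ) : volume (unitCube k) = 1 := by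
  have h : unitCube k = (WithLp.ofLp : EuclideanSpace ℝ (Fin d) → _) ⁻¹'
      Set.pi Set.univ fun i => Set.Ico (k i : ℝ) (k i + 1) := by
    ext x
    simp [unitCube, Int.floor_eq_iff, Set.mem_pi]
  rw [h, (PiLp.volume_preserving_ofLp (Fin d)).measure_preimage
    (MeasurableSet.univ_pi fun i => measurableSet_Ico).nullMeasurableSet, Real.volume_pi_Ico]
  simp

theorem pairwise_disjoint_unitCube :
    Pairwise (Function.onFun Disjoint (unitCube : (Fin d → ℤ) → _)) := fun _ _ hne =>
  Set.disjoint_left.2 fun _ hx hx' => hne (funext fun i => (hx i).symm.trans (hx' i))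

instance isProbabilityMeasure_restrict_unitCube (k : Fin d → ℤ) :
    IsProbabilityMeasure ((volume : Measure (EuclideanSpace ℝ (Fin d))).restrict (unitCube k)) :=
  ⟨by rw [Measure.restrict_apply_univ, volume_unitCube]⟩

/-- The corners of the unit cubes that meet the closed ball of radius `R`. -/
def cubeIndices (d : ℕ) (R : ℝ) : Finset (Fin d → ℤ) :=
  Finset.Icc (fun _ => ⌊-R⌋) (fun _ => ⌊R⌋)

theorem mem_cubeIndices {R : ℝ} {k : Fin d → ℤ} {x : EuclideanSpace ℝ (Fin d)}
    (hx : x ∈ unitCube k) (hR : x ∈ Metric.closedBall 0 R) : k ∈ cubeIndices d R := by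
  rw [mem_closedBall_zero_iff] at hR
  have h : ∀ i, -R ≤ x i ∧ x i ≤ R := fun i =>
    abs_le.1 (((Real.norm_eq_abs _).symm.le.trans (PiLp.norm_apply_le x i)).trans hR)
  refine Finset.mem_Icc.2 ⟨fun i => ?_, fun i => ?_⟩
  · rw [← hx i]; exact Int.floor_mono (h i).1
  · rw [← hx i]; exact Int.floor_mono (h i).2

/-- The counting measure of the first `y.1` points of the sequence `y.2`, restricted to the unit
cube at `k`. -/
def cubePoints (k : Fin d → ℤ) (y : ℕ × (ℕ → EuclideanSpace ℝ (Fin d))) :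
    Measure (EuclideanSpace ℝ (Fin d)) :=
  (∑ i ∈ Finset.range y.1, Measure.dirac (y.2 i)).restrict (unitCube k)

instance isFiniteMeasure_cubePoints (k : Fin d → ℤ)
    (y : ℕ × (ℕ → EuclideanSpace ℝ (Fin d))) : IsFiniteMeasure (cubePoints k y) := by
  unfold cubePoints; infer_instance

theorem cubePoints_eq_zero {k : Fin d → ℤ} {R : ℝ} (hk : k ∉ cubeIndices d R)
    (y : ℕ × (ℕ → EuclideanSpace ℝ (Fin d))) : cubePoints k y (Metric.closedBall 0 R) = 0 := by
  rw [cubePoints, Measure.restrict_apply Metric.isClosed_closedBall.measurableSet]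
  have : Metric.closedBall 0 R ∩ unitCube k = ∅ :=
    Set.eq_empty_iff_forall_notMem.2 fun x hx => hk (mem_cubeIndices hx.2 hx.1)
  rw [this, measure_empty]

theorem integral_cubePoints {k : Fin d → ℤ} {f : EuclideanSpace ℝ (Fin d) → ℝ}
    (hf : Measurable f) (y : ℕ × (ℕ → EuclideanSpace ℝ (Fin d))) :
    ∫ x, f x ∂(cubePoints k y) = ∑ i ∈ Finset.range y.1, (unitCube k).indicator f (y.2 i) := by
  have hm := hf.indicator (measurableSet_unitCube k)
  rw [cubePoints, ← integral_indicator (measurableSet_unitCube k), integral_finsetSum_measure]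
  · exact Finset.sum_congr rfl fun i _ => integral_dirac' _ _ hm.stronglyMeasurable
  · intro i _
    exact integrable_dirac' hm.stronglyMeasurable (by simp)

theorem measurable_integral_cubePoints {k : Fin d → ℤ} {f : EuclideanSpace ℝ (Fin d) → ℝ}
    (hf : Measurable f) : Measurable fun y => ∫ x, f x ∂(cubePoints k y) := by
  have hm := hf.indicator (measurableSet_unitCube k)
  simp_rw [integral_cubePoints hf]
  refine measurable_from_prod_countable_right fun N => ?_
  exact Finset.measurable_sum (Finset.range N) fun i _ => hm.comp (measurable_pi_apply i)

/-- A Poisson number of independent points, uniformly distributed in the unit cube at `k`. -/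
def cubeLaw (lam : ℝ≥0) (k : Fin d → ℤ) : Measure (ℕ × (ℕ → EuclideanSpace ℝ (Fin d))) :=
  (poissonMeasure lam).prod (Measure.infinitePi fun _ => volume.restrict (unitCube k))

instance isProbabilityMeasure_cubeLaw (lam : ℝ≥0) (k : Fin d → ℤ) :
    IsProbabilityMeasure (cubeLaw lam k) := by
  unfold cubeLaw; infer_instance

theorem integral_pow_poissonMeasure (r : ℝ≥0) (z : ℂ) :
    ∫ n, z ^ n ∂(poissonMeasure r) = Complex.exp (r * (z - 1)) := by
  rw [integral_poissonMeasure]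
  have h := (NormedSpace.expSeries_div_hasSum_exp (r * z : ℂ)).tsum_eq
  rw [← Complex.exp_eq_exp_ℂ] at h
  calc ∑' n : ℕ, (Real.exp (-r) * r ^ n / n.factorial) • z ^ n
      = ∑' n : ℕ, (Real.exp (-r) : ℂ) * ((r * z) ^ n / n.factorial) := by
        congr with n
        rw [Complex.real_smul]
        push_cast
        rw [mul_pow]
        ring
    _ = Complex.exp (r * (z - 1)) := by
        rw [tsum_mul_left, h, Complex.ofReal_exp, ← Complex.exp_add]
        congr 1
        push_cast
        ring

theorem norm_exp_I_mul_ofReal (x : ℝ) : ‖Complex.exp (Complex.I * x)‖ = 1 := by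
  rw [mul_comm, Complex.norm_exp_ofReal_mul_I]

theorem integrable_exp_I_mul {α : Type*} [MeasurableSpace α] {μ : Measure α} [IsFiniteMeasure μ]
    {f : α → ℝ} (hf : Measurable f) : Integrable (fun x => Complex.exp (Complex.I * f x)) μ :=
  Integrable.of_bound (by fun_prop) 1
    (Eventually.of_forall fun x => (norm_exp_I_mul_ofReal (f x)).le)

/-- Given the number `N` of points, independence yields the `N`-th power of the mean of `exp(i f)`
over the cube; the Poisson generating function sums these powers. The cube has volume `1`, so the
mean minus `1` is the integral of `exp(i f) - 1`. -/
theorem charFunctional_cubePoints (lam : ℝ≥0) (k : Fin d → ℤ)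
    {f : EuclideanSpace ℝ (Fin d) → ℝ} (hf : Measurable f) :
    ∫ y, Complex.exp (Complex.I * (∫ x, f x ∂(cubePoints k y) : ℝ)) ∂(cubeLaw lam k) =
      Complex.exp (lam * ∫ x in unitCube k, (Complex.exp (Complex.I * f x) - 1)) := by
  have hm := hf.indicator (measurableSet_unitCube k)
  set h := (unitCube k).indicator f with hh
  rw [cubeLaw, integral_prod _ (integrable_exp_I_mul (measurable_integral_cubePoints hf))]
  have hφ : ∫ x in unitCube k, Complex.exp (Complex.I * h x) =
      ∫ x in unitCube k, Complex.exp (Complex.I * f x) :=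
    setIntegral_congr_fun (measurableSet_unitCube k) fun x hx => by
      simp only [hh, Set.indicator_of_mem hx]
  have hinner : ∀ N : ℕ, ∫ u : ℕ → EuclideanSpace ℝ (Fin d),
      Complex.exp (Complex.I * (∫ x, f x ∂(cubePoints k (N, u)) : ℝ))
        ∂(Measure.infinitePi fun _ => volume.restrict (unitCube k)) =
      (∫ x in unitCube k, Complex.exp (Complex.I * f x)) ^ N := by
    intro N
    have hexp : Measurable fun x => Complex.exp (Complex.I * h x) := by fun_prop
    have hind : iIndepFun (fun (i : Fin N) (u : ℕ → EuclideanSpace ℝ (Fin d)) => u i)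
        (Measure.infinitePi fun _ => volume.restrict (unitCube k)) :=
      (iIndepFun_infinitePi (X := fun (_ : ℕ) (x : EuclideanSpace ℝ (Fin d)) => x)
        fun _ => measurable_id).precomp Fin.val_injective
    have := hind.integral_fun_prod_comp
      (f := fun _ x => Complex.exp (Complex.I * h x)) (fun i => (measurable_pi_apply _).aemeasurable)
      fun i => hexp.aestronglyMeasurable
    have heach : ∀ i : ℕ, ∫ u : ℕ → EuclideanSpace ℝ (Fin d), Complex.exp (Complex.I * h (u i))
        ∂(Measure.infinitePi fun _ => volume.restrict (unitCube k)) =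
        ∫ x in unitCube k, Complex.exp (Complex.I * f x) := fun i => by
      have hmp := measurePreserving_eval_infinitePi
        (fun _ : ℕ => (volume : Measure (EuclideanSpace ℝ (Fin d))).restrict (unitCube k)) i
      rw [← hφ]
      conv_rhs => rw [← hmp.map_eq]
      rw [integral_map hmp.measurable.aemeasurable hexp.aestronglyMeasurable]
    simp only [heach, Finset.prod_const, Finset.card_univ, Fintype.card_fin] at this
    rw [← this]
    refine integral_congr_ae (Eventually.of_forall fun u => ?_)
    simp only [integral_cubePoints hf]
    rw [← Complex.exp_sum, Finset.sum_range, Complex.ofReal_sum, Finset.mul_sum]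
  simp_rw [hinner]
  rw [integral_pow_poissonMeasure, integral_sub (integrable_exp_I_mul hf) (integrable_const _)]
  simp

/-- The superposition of the points in all the unit cubes. -/
def superposition (ω : (Fin d → ℤ) → ℕ × (ℕ → EuclideanSpace ℝ (Fin d))) :
    Measure (EuclideanSpace ℝ (Fin d)) :=
  Measure.sum fun k => cubePoints k (ω k)

/-- This holds for every `ω`, not just almost surely, since `cubePoints` discards sample points
outside its cube and only finitely many cubes meet a ball. -/
theorem isLocallyFiniteMeasure_superposition
    (ω : (Fin d → ℤ) → ℕ × (ℕ → EuclideanSpace ℝ (Fin d))) :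
    IsLocallyFiniteMeasure (superposition ω) := by
  refine ⟨fun a => ⟨Metric.ball a 1, Metric.ball_mem_nhds a one_pos, ?_⟩⟩
  obtain ⟨R, hR⟩ := (Metric.isBounded_ball (x := a) (r := 1)).subset_closedBall 0
  refine (measure_mono hR).trans_lt ?_
  rw [superposition, Measure.sum_apply _ Metric.isClosed_closedBall.measurableSet,
    tsum_eq_sum (s := cubeIndices d R) fun k hk => cubePoints_eq_zero hk _]
  exact ENNReal.sum_lt_top.2 fun k _ => measure_lt_top _ _

theorem integral_superposition {f : EuclideanSpace ℝ (Fin d) → ℝ} (hf : Measurable f) {C R : ℝ}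
    (hC : ∀ x, |f x| ≤ C) (hR : ∀ x ∉ Metric.closedBall 0 R, f x = 0)
    (ω : (Fin d → ℤ) → ℕ × (ℕ → EuclideanSpace ℝ (Fin d))) :
    ∫ x, f x ∂(superposition ω) = ∑ k ∈ cubeIndices d R, ∫ x, f x ∂(cubePoints k (ω k)) :=
  integral_measureSum_of_support Metric.isClosed_closedBall.measurableSet _
    (fun _ hk => cubePoints_eq_zero hk _) hR
    fun _ _ => Integrable.of_bound hf.aestronglyMeasurable C (Eventually.of_forall hC)

/-- Distinct cubes are independent, so their functionals multiply; the cubes tile the support of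
`f`, so the exponents add up to one integral. -/
theorem charFunctional_superposition (lam : ℝ≥0)
    {f : EuclideanSpace ℝ (Fin d) → ℝ} (hf : Measurable f) {C R : ℝ}
    (hC : ∀ x, |f x| ≤ C) (hR : ∀ x ∉ Metric.closedBall 0 R, f x = 0) :
    ∫ ω, Complex.exp (Complex.I * (∫ x, f x ∂(superposition ω) : ℝ))
      ∂(Measure.infinitePi (cubeLaw (d := d) lam)) =
      Complex.exp (lam * ∫ x, (Complex.exp (Complex.I * f x) - 1)) := by
  set K := cubeIndices d R
  have hind : iIndepFun (fun (k : K) (ω : (Fin d → ℤ) → ℕ × (ℕ → EuclideanSpace ℝ (Fin d))) => ω k)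
      (Measure.infinitePi (cubeLaw (d := d) lam)) :=
    (iIndepFun_infinitePi (X := fun (_ : Fin d → ℤ)
      (y : ℕ × (ℕ → EuclideanSpace ℝ (Fin d))) => y)
        fun _ => measurable_id).precomp Subtype.val_injective
  have hm : ∀ k, Measurable fun y => Complex.exp (Complex.I * (∫ x, f x ∂(cubePoints k y) : ℝ)) :=
    fun k => by have := measurable_integral_cubePoints (k := k) hf; fun_prop
  have hprod := hind.integral_fun_prod_comp
    (f := fun (k : K) y => Complex.exp (Complex.I * (∫ x, f x ∂(cubePoints k.1 y) : ℝ)))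
    (fun i => (measurable_pi_apply _).aemeasurable) fun k => (hm k).aestronglyMeasurable
  have heach : ∀ k : K, ∫ ω, Complex.exp (Complex.I * (∫ x, f x ∂(cubePoints k (ω k)) : ℝ))
      ∂(Measure.infinitePi (cubeLaw (d := d) lam)) =
      Complex.exp (lam * ∫ x in unitCube k, (Complex.exp (Complex.I * f x) - 1)) := fun k => by
    have hmp := measurePreserving_eval_infinitePi (cubeLaw (d := d) lam) k
    rw [← charFunctional_cubePoints lam k hf]
    conv_rhs => rw [← hmp.map_eq]
    rw [integral_map hmp.measurable.aemeasurable (hm k).aestronglyMeasurable]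
  simp only [heach] at hprod
  have hcover : ∀ x ∉ ⋃ k ∈ K, unitCube k, Complex.exp (Complex.I * f x) - 1 = 0 := by
    intro x hx
    rw [hR x fun hxR => hx ?_]
    · simp
    · exact Set.mem_iUnion₂.2 ⟨fun i => ⌊x i⌋, mem_cubeIndices (fun i => rfl) hxR, fun i => rfl⟩
  have hsum : ∫ x, (Complex.exp (Complex.I * f x) - 1) =
      ∑ k ∈ K, ∫ x in unitCube k, (Complex.exp (Complex.I * f x) - 1) := by
    rw [← setIntegral_eq_integral_of_forall_compl_eq_zero hcover,
      integral_biUnion_finset K (fun k _ => measurableSet_unitCube k)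
        (fun k _ k' _ h => pairwise_disjoint_unitCube h)]
    exact fun k _ => (integrable_exp_I_mul hf).sub (integrable_const _)
  rw [hsum, Finset.mul_sum, Complex.exp_sum,
    ← Finset.prod_coe_sort K fun k =>
      Complex.exp (lam * ∫ x in unitCube k, (Complex.exp (Complex.I * f x) - 1)), ← hprod]
  refine integral_congr_ae (Eventually.of_forall fun ω => ?_)
  simp only
  rw [integral_superposition hf hC hR, ← Complex.exp_sum, ← Finset.sum_coe_sort,
    Complex.ofReal_sum, Finset.mul_sum]

/-- The superposition, as a locally finite measure. -/
def locFinSuperposition (ω : (Fin d → ℤ) → ℕ × (ℕ → EuclideanSpace ℝ (Fin d))) :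
    LocFinMeasure d :=
  ⟨superposition ω, isLocallyFiniteMeasure_superposition ω⟩

theorem measurable_locFinSuperposition : Measurable (locFinSuperposition (d := d)) := by
  refine LocFinMeasure.measurable_of_integral fun f hf hfc hf0 => ?_
  obtain ⟨C, hC⟩ := hfc.exists_bound_of_continuous hf
  obtain ⟨R, hR⟩ := hfc.isCompact.isBounded.subset_closedBall (0 : EuclideanSpace ℝ (Fin d))
  have hR' : ∀ x ∉ Metric.closedBall 0 R, f x = 0 := fun x hx =>
    image_eq_zero_of_notMem_tsupport fun h => hx (hR h)
  simp_rw [locFinSuperposition, integral_superposition hf.measurable hC hR']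
  exact Finset.measurable_sum _ fun k _ =>
    (measurable_integral_cubePoints hf.measurable).comp (measurable_pi_apply k)

/-- The law of the homogeneous Poisson process. -/
def poissonProcessLaw (d : ℕ) (lam : ℝ≥0) : ProbabilityMeasure (LocFinMeasure d) :=
  ⟨(Measure.infinitePi (cubeLaw (d := d) lam)).map locFinSuperposition,
    Measure.isProbabilityMeasure_map measurable_locFinSuperposition.aemeasurable⟩

/-- Continuity of `f` is not required, so that the formula applies to step functions as well as to
test functions. -/
theorem charFunctional_poissonProcessLaw (lam : ℝ≥0)
    {f : EuclideanSpace ℝ (Fin d) → ℝ} (hf : Measurable f) {C R : ℝ}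
    (hC : ∀ x, |f x| ≤ C) (hR : ∀ x ∉ Metric.closedBall 0 R, f x = 0)
    (hm : Measurable fun ν : LocFinMeasure d => ∫ x, f x ∂ν.1) :
    ∫ ν, Complex.exp (Complex.I * (∫ x, f x ∂ν.1 : ℝ))
      ∂(poissonProcessLaw d lam : Measure (LocFinMeasure d)) =
      Complex.exp (lam * ∫ x, (Complex.exp (Complex.I * f x) - 1)) := by
  have hexp : Measurable fun ν : LocFinMeasure d =>
      Complex.exp (Complex.I * (∫ x, f x ∂ν.1 : ℝ)) :=
    Complex.measurable_exp.comp (hm.complex_ofReal.const_mul _)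
  rw [← charFunctional_superposition lam hf hC hR, poissonProcessLaw, ProbabilityMeasure.coe_mk,
    integral_map measurable_locFinSuperposition.aemeasurable hexp.aestronglyMeasurable]
  rfl

end PoissonConstruction

/-! ### Masses of disjoint sets under the Poisson law -/

section PoissonLaw

variable {d : ℕ}

theorem LocFinMeasure.integral_sum_indicator {m : ℕ} {A : Fin m → Set (EuclideanSpace ℝ (Fin d))}
    (hA : ∀ i, MeasurableSet (A i)) (hb : ∀ i, Bornology.IsBounded (A i)) (t : Fin m → ℝ)
    (ν : LocFinMeasure d) :
    ∫ x, ∑ i, (A i).indicator (fun _ => t i) x ∂ν.1 = ∑ i, t i * ν.1.real (A i) := by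
  rw [integral_finsetSum]
  · refine Finset.sum_congr rfl fun i _ => ?_
    rw [integral_indicator_const _ (hA i), smul_eq_mul, mul_comm]
  · exact fun i _ => (integrable_indicator_iff (hA i)).2
      (integrableOn_const (ν.measure_lt_top_of_isBounded (hb i)).ne)

/-- The joint characteristic function of the masses of disjoint bounded Borel sets. -/
theorem charFun_masses_poissonProcessLaw (lam : ℝ≥0) {m : ℕ}
    {A : Fin m → Set (EuclideanSpace ℝ (Fin d))}
    (hA : ∀ i, MeasurableSet (A i)) (hb : ∀ i, Bornology.IsBounded (A i))
    (hd : Pairwise (Function.onFun Disjoint A)) (t : Fin m → ℝ) :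
    ∫ ν : LocFinMeasure d, Complex.exp (Complex.I * (∑ i, t i * ν.1.real (A i) : ℝ))
      ∂(poissonProcessLaw d lam : Measure (LocFinMeasure d)) =
      ∏ i, Complex.exp ((lam * (volume (A i)).toNNReal : ℝ≥0) *
        (Complex.exp (Complex.I * t i) - 1)) := by
  let f : EuclideanSpace ℝ (Fin d) → ℝ := fun x => ∑ i, (A i).indicator (fun _ => t i) x
  have hf : Measurable f :=
    Finset.measurable_sum _ fun i _ => measurable_const.indicator (hA i)
  have hC : ∀ x, |f x| ≤ ∑ i, |t i| := fun x =>
    (Finset.abs_sum_le_sum_abs _ _).trans (Finset.sum_le_sum fun i _ => by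
      by_cases hx : x ∈ A i <;> simp [hx])
  obtain ⟨R, hR⟩ := (Bornology.isBounded_iUnion.2 hb).subset_closedBall
    (0 : EuclideanSpace ℝ (Fin d))
  have hR' : ∀ x ∉ Metric.closedBall 0 R, f x = 0 := fun x hx =>
    Finset.sum_eq_zero fun i _ =>
      Set.indicator_of_notMem (fun hi => hx (hR (Set.mem_iUnion.2 ⟨i, hi⟩))) _
  have hint : ∀ ν : LocFinMeasure d, ∫ x, f x ∂ν.1 = ∑ i, t i * ν.1.real (A i) :=
    LocFinMeasure.integral_sum_indicator hA hb t
  have hm : Measurable fun ν : LocFinMeasure d => ∫ x, f x ∂ν.1 := by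
    simp_rw [hint]
    exact Finset.measurable_sum _ fun i _ =>
      ((LocFinMeasure.measurable_apply (hA i)).ennreal_toReal).const_mul _
  -- By disjointness at most one indicator is nonzero at each point, so `exp(i f) - 1` is additive
  -- over the sets and the functional factorises.
  have hexp : ∀ x, Complex.exp (Complex.I * f x) - 1 =
      ∑ i, (A i).indicator (fun _ => Complex.exp (Complex.I * t i) - 1) x := by
    intro x
    by_cases hx : ∃ i, x ∈ A i
    · obtain ⟨i, hi⟩ := hx
      have hne : ∀ j, j ≠ i → x ∉ A j := fun j hj hxj => Set.disjoint_left.1 (hd hj) hxj hi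
      have h1 : f x = t i := by
        simp only [f]
        rw [Finset.sum_eq_single i (fun j _ hj => Set.indicator_of_notMem (hne j hj) _) (by simp),
          Set.indicator_of_mem hi]
      rw [Finset.sum_eq_single i (fun j _ hj => Set.indicator_of_notMem (hne j hj) _) (by simp),
        Set.indicator_of_mem hi, h1]
    · push Not at hx
      have h1 : f x = 0 := Finset.sum_eq_zero fun i _ => Set.indicator_of_notMem (hx i) _
      rw [h1, Finset.sum_eq_zero fun i _ => Set.indicator_of_notMem (hx i) _]
      simp
  have key := charFunctional_poissonProcessLaw lam hf hC hR' hm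
  simp_rw [hint] at key
  rw [key, ← Complex.exp_sum]
  simp_rw [hexp]
  rw [integral_finsetSum, Finset.mul_sum]
  · congr 1
    refine Finset.sum_congr rfl fun i _ => ?_
    rw [integral_indicator_const _ (hA i), Complex.real_smul, measureReal_def]
    push_cast
    rw [← mul_assoc]
  · exact fun i _ => (integrable_indicator_iff (hA i)).2
      (integrableOn_const (hb i).measure_lt_top.ne)

theorem measurable_real_apply {A : Set (EuclideanSpace ℝ (Fin d))} (hA : MeasurableSet A) :
    Measurable fun ν : LocFinMeasure d => ν.1.real A :=
  (LocFinMeasure.measurable_apply hA).ennreal_toReal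

theorem charFun_map_real_poissonProcessLaw (lam : ℝ≥0) {A : Set (EuclideanSpace ℝ (Fin d))}
    (hA : MeasurableSet A) (hb : Bornology.IsBounded A) (t : ℝ) :
    charFun ((poissonProcessLaw d lam : Measure (LocFinMeasure d)).map fun ν => ν.1.real A) t =
      Complex.exp ((lam * (volume A).toNNReal : ℝ≥0) * (Complex.exp (Complex.I * t) - 1)) := by
  have h := charFun_masses_poissonProcessLaw lam (m := 1) (A := fun _ => A) (fun _ => hA)
    (fun _ => hb) (fun i j hij => absurd (Subsingleton.elim i j) hij) (fun _ => t)
  simp only [Finset.univ_unique, Finset.sum_singleton, Finset.prod_singleton] at h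
  rw [← h, charFun_apply_real, integral_map (measurable_real_apply hA).aemeasurable (by fun_prop)]
  refine integral_congr_ae (Eventually.of_forall fun ν => ?_)
  simp only
  push_cast
  ring_nf

theorem isPoissonProcessLaw_poissonProcessLaw (lam : ℝ≥0) :
    IsPoissonProcessLaw lam (poissonProcessLaw d lam : Measure (LocFinMeasure d)) where
  hasLaw A hA hb := by
    have hreal : (poissonProcessLaw d lam : Measure (LocFinMeasure d)).map (fun ν => ν.1.real A) =
        (poissonMeasure (lam * (volume A).toNNReal)).map (fun k : ℕ => (k : ℝ)) := by
      have h1 : IsProbabilityMeasure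
          ((poissonProcessLaw d lam : Measure (LocFinMeasure d)).map fun ν => ν.1.real A) :=
        Measure.isProbabilityMeasure_map (measurable_real_apply hA).aemeasurable
      refine Measure.ext_of_charFun (funext fun t => ?_)
      rw [charFun_map_real_poissonProcessLaw lam hA hb, charFun_map_cast_poissonMeasure,
        mul_comm Complex.I]
    refine ⟨(LocFinMeasure.measurable_apply hA).aemeasurable, ?_⟩
    -- Characteristic functions identify the law of the real-valued mass; as bounded sets have
    -- finite mass, `ENNReal.ofReal` recovers the extended one.
    have h2 : (fun ν : LocFinMeasure d => ν.1 A) = ENNReal.ofReal ∘ fun ν => ν.1.real A :=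
      funext fun ν => (ENNReal.ofReal_toReal (ν.measure_lt_top_of_isBounded hb).ne).symm
    rw [h2, ← Measure.map_map ENNReal.measurable_ofReal (measurable_real_apply hA), hreal,
      Measure.map_map ENNReal.measurable_ofReal (by fun_prop)]
    exact congrArg (fun φ => Measure.map φ _) (funext fun k => by simp)
  indep m A hA hb hd := by
    have hreal : iIndepFun (fun (i : Fin m) (ν : LocFinMeasure d) => ν.1.real (A i))
        (poissonProcessLaw d lam : Measure (LocFinMeasure d)) := by
      refine (iIndepFun_iff_charFun_pi fun i => (measurable_real_apply (hA i)).aemeasurable).2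
        fun t => ?_
      have hmeas : Measurable fun ν : LocFinMeasure d =>
          (WithLp.toLp 2 fun i : Fin m => ν.1.real (A i) : EuclideanSpace ℝ (Fin m)) := by
        have : Measurable fun (ν : LocFinMeasure d) (i : Fin m) => ν.1.real (A i) :=
          measurable_pi_lambda _ fun i => measurable_real_apply (hA i)
        exact (WithLp.measurable_toLp 2 _).comp this
      simp_rw [charFun_map_real_poissonProcessLaw lam (hA _) (hb _)]
      rw [← charFun_masses_poissonProcessLaw lam hA hb hd, charFun_apply,
        integral_map hmeas.aemeasurable (by fun_prop)]
      refine integral_congr_ae (Eventually.of_forall fun ν => ?_)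
      simp only [PiLp.inner_apply, Real.inner_apply]
      rw [mul_comm]
      simp_rw [mul_comm (t _)]
    have h2 := hreal.comp (fun _ => ENNReal.ofReal) fun _ => ENNReal.measurable_ofReal
    convert h2 using 2 with i
    exact funext fun ν => (ENNReal.ofReal_toReal (ν.measure_lt_top_of_isBounded (hb i)).ne).symm

end PoissonLaw

/-! ### Riemann sums over the scaled lattice -/

section RiemannSum

variable {d : ℕ}

theorem mem_cubeIndices_of_smul_latticePoint {R : ℝ} {n : ℕ} (hn : n ≠ 0) {j : Fin d → ℤ}
    (hj : (n : ℝ)⁻¹ • latticePoint j ∈ Metric.closedBall (0 : EuclideanSpace ℝ (Fin d)) R) :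
    j ∈ cubeIndices d (n * R) := by
  have hn' : (0 : ℝ) < n := by positivity
  refine mem_cubeIndices (x := latticePoint j) (fun i => by simp [latticePoint]) ?_
  rw [mem_closedBall_zero_iff, norm_smul, norm_inv, Real.norm_natCast] at hj
  rw [mem_closedBall_zero_iff]
  rwa [inv_mul_le_iff₀ hn'] at hj

theorem card_cubeIndices_le (d : ℕ) {R : ℝ} (hR : 0 ≤ R) {n : ℕ} (hn : n ≠ 0) :
    ((cubeIndices d (n * R)).card : ℝ) ≤ (2 * R + 2) ^ d * n ^ d := by
  have hn1 : (1 : ℝ) ≤ n := by exact_mod_cast Nat.one_le_iff_ne_zero.2 hn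
  rw [cubeIndices, Pi.card_Icc, Finset.prod_const, Finset.card_univ, Fintype.card_fin, ← mul_pow,
    Int.card_Icc]
  push_cast
  -- Each side of the index box has at most `2 n R + 2 ≤ (2 R + 2) n` integers, using `n ≥ 1`.
  refine pow_le_pow_left₀ (by positivity) ?_ d
  have h1 : (⌊(n : ℝ) * R⌋ : ℝ) ≤ n * R := Int.floor_le _
  have h2 : -((n : ℝ) * R) < ⌊-((n : ℝ) * R)⌋ + 1 := Int.lt_floor_add_one _
  have h3 : ((⌊(n : ℝ) * R⌋ + 1 - ⌊-((n : ℝ) * R)⌋).toNat : ℝ) =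
      max ((⌊(n : ℝ) * R⌋ : ℝ) + 1 - ⌊-((n : ℝ) * R)⌋) 0 := by
    have := Int.toNat_eq_max (⌊(n : ℝ) * R⌋ + 1 - ⌊-((n : ℝ) * R)⌋)
    exact_mod_cast this
  rw [h3]
  have : 0 ≤ (n : ℝ) * R := by positivity
  exact max_le (by nlinarith) (by positivity)

theorem tendsto_riemannSum_real {g : EuclideanSpace ℝ (Fin d) → ℝ} (hg : Continuous g) {R : ℝ}
    (hR : ∀ x ∉ Metric.closedBall 0 R, g x = 0) :
    Tendsto (fun n : ℕ => (∑ j ∈ cubeIndices d (n * R), g ((n : ℝ)⁻¹ • latticePoint j)) / n ^ d)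
      atTop (𝓝 (∫ x, g x)) := by
  let F : (Fin d → ℝ) → ℝ := fun x => g (WithLp.toLp 2 x)
  have hF : Continuous F := by fun_prop
  -- This is a sup-norm ball: it contains the Euclidean ball of the same radius, and its frontier is
  -- null by convexity.
  let s : Set (Fin d → ℝ) := Metric.closedBall 0 R
  have hFs : ∀ x ∉ s, F x = 0 := fun x hx => hR _ fun h => hx <| by
    rw [mem_closedBall_zero_iff] at h ⊢
    have h0 : 0 ≤ R := (norm_nonneg _).trans h
    exact (pi_norm_le_iff_of_nonneg h0).2 fun i =>
      (PiLp.norm_apply_le (WithLp.toLp 2 x : EuclideanSpace ℝ (Fin d)) i).trans h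
  have key := tendsto_tsum_div_pow_atTop_integral s F hF Metric.isBounded_closedBall
    Metric.isClosed_closedBall.measurableSet ((convex_closedBall _ _).addHaar_frontier volume)
  rw [setIntegral_eq_integral_of_forall_compl_eq_zero hFs, Fintype.card_fin] at key
  have hint : ∫ x, F x = ∫ x, g x :=
    (PiLp.volume_preserving_toLp (Fin d)).integral_comp
      (MeasurableEquiv.toLp 2 (Fin d → ℝ)).measurableEmbedding g
  rw [hint] at key
  refine key.congr' ?_
  filter_upwards [eventually_ne_atTop 0] with n hn
  have hn' : (n : ℝ) ≠ 0 := by exact_mod_cast hn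
  congr 1
  let φ : (Fin d → ℤ) → (Fin d → ℝ) := fun j => (n : ℝ)⁻¹ • fun i => (j i : ℝ)
  have hφ : Function.Injective φ := fun j j' h => by
    have := smul_right_injective (Fin d → ℝ) (inv_ne_zero hn') h
    funext i
    exact_mod_cast congrFun this i
  have hrange : ((n : ℝ)⁻¹ • (Submodule.span ℤ (Set.range (Pi.basisFun ℝ (Fin d))) :
      Set (Fin d → ℝ))) = Set.range φ := by
    ext x
    rw [Set.mem_smul_set]
    constructor
    · rintro ⟨y, hy, rfl⟩
      rw [SetLike.mem_coe, Module.Basis.mem_span_iff_repr_mem] at hy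
      choose j hj using hy
      refine ⟨j, ?_⟩
      simp only [φ]
      congr 1
      funext i
      simpa using hj i
    · rintro ⟨j, rfl⟩
      refine ⟨_, ?_, rfl⟩
      rw [SetLike.mem_coe, Module.Basis.mem_span_iff_repr_mem]
      exact fun i => ⟨j i, by simp⟩
  rw [hrange, tsum_subtype (s ∩ Set.range φ) F, ← hφ.tsum_eq]
  · have hval : ∀ j, (s ∩ Set.range φ).indicator F (φ j) = g ((n : ℝ)⁻¹ • latticePoint j) := by
      intro j
      have h1 : F (φ j) = g ((n : ℝ)⁻¹ • latticePoint j) := rfl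
      by_cases hj : φ j ∈ s
      · rw [Set.indicator_of_mem (show φ j ∈ s ∩ Set.range φ from ⟨hj, Set.mem_range_self j⟩), h1]
      · rw [Set.indicator_of_notMem fun h => hj h.1, ← h1, hFs _ hj]
    simp_rw [hval]
    exact tsum_eq_sum fun j hj => hR _ fun h => hj (mem_cubeIndices_of_smul_latticePoint hn h)
  · intro x hx
    by_contra h
    exact hx (Set.indicator_of_notMem (fun h' => h h'.2) _)

theorem tendsto_riemannSum {g : EuclideanSpace ℝ (Fin d) → ℂ} (hg : Continuous g) {R : ℝ}
    (hR : ∀ x ∉ Metric.closedBall 0 R, g x = 0) :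
    Tendsto (fun n : ℕ => (∑ j ∈ cubeIndices d (n * R), g ((n : ℝ)⁻¹ • latticePoint j)) / n ^ d)
      atTop (𝓝 (∫ x, g x)) := by
  have hint : Integrable g := hg.integrable_of_hasCompactSupport
    (HasCompactSupport.intro (isCompact_closedBall 0 R) hR)
  have hre := tendsto_riemannSum_real (g := fun x => (g x).re) (Complex.continuous_re.comp hg)
    (R := R) fun x hx => by simp [hR x hx]
  have him := tendsto_riemannSum_real (g := fun x => (g x).im) (Complex.continuous_im.comp hg)
    (R := R) fun x hx => by simp [hR x hx]
  have hlim := ((Complex.continuous_ofReal.tendsto _).comp hre).add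
    (((Complex.continuous_ofReal.tendsto _).comp him).mul_const Complex.I)
  have h1 := integral_re_add_im hint
  simp only [RCLike.re_eq_complex_re, RCLike.im_eq_complex_im, Complex.coe_algebraMap,
    RCLike.I_to_complex] at h1
  rw [← h1]
  refine hlim.congr fun n => ?_
  simp only [Function.comp_apply]
  push_cast
  rw [div_mul_eq_mul_div, ← add_div, Finset.sum_mul, ← Finset.sum_add_distrib]
  simp_rw [Complex.re_add_im]

end RiemannSum

/-! ### The Poisson limit of the rescaled fields -/

section PoissonLimit

variable {d : ℕ}

theorem norm_prod_sub_prod_le {ι : Type*} (s : Finset ι) {a b : ι → ℂ} (ha : ∀ j ∈ s, ‖a j‖ ≤ 1)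
    (hb : ∀ j ∈ s, ‖b j‖ ≤ 1) : ‖∏ j ∈ s, a j - ∏ j ∈ s, b j‖ ≤ ∑ j ∈ s, ‖a j - b j‖ := by
  classical
  induction s using Finset.induction_on with
  | empty => simp
  | insert k s hk ih =>
    rw [Finset.prod_insert hk, Finset.prod_insert hk, Finset.sum_insert hk]
    have hsplit : a k * ∏ j ∈ s, a j - b k * ∏ j ∈ s, b j =
        (a k - b k) * ∏ j ∈ s, a j + b k * (∏ j ∈ s, a j - ∏ j ∈ s, b j) := by ring
    have h1 : ‖∏ j ∈ s, a j‖ ≤ 1 := by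
      rw [norm_prod]
      exact Finset.prod_le_one (fun _ _ => norm_nonneg _)
        fun j hj => ha j (Finset.mem_insert_of_mem hj)
    rw [hsplit]
    refine (norm_add_le _ _).trans (add_le_add ?_ ?_)
    · rw [norm_mul]; exact mul_le_of_le_one_right (norm_nonneg _) h1
    · rw [norm_mul]
      exact (mul_le_of_le_one_left (norm_nonneg _) (hb k (Finset.mem_insert_self _ _))).trans
        (ih (fun j hj => ha j (Finset.mem_insert_of_mem hj))
          fun j hj => hb j (Finset.mem_insert_of_mem hj))

/-- With `w = p (z - 1)` one has `|w| ≤ 2 p ≤ 1`, hence `|exp w - 1 - w| ≤ |w|^2`. All factors lie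
in the unit disc, so the errors merely add. -/
theorem norm_prod_sub_exp_le {ι : Type*} (s : Finset ι) {z : ι → ℂ} (hz : ∀ j ∈ s, ‖z j‖ ≤ 1)
    {p : ℝ} (hp0 : 0 ≤ p) (hp : 2 * p ≤ 1) :
    ‖∏ j ∈ s, (1 + (p : ℂ) * (z j - 1)) - Complex.exp (p * ∑ j ∈ s, (z j - 1))‖ ≤
      s.card * (2 * p) ^ 2 := by
  rw [Finset.mul_sum, Complex.exp_sum]
  refine (norm_prod_sub_prod_le s (fun j hj => ?_) fun j hj => ?_).trans ?_
  · exact norm_one_add_mul_sub_one_le hp0 (by linarith) (hz j hj)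
  · rw [Complex.norm_exp, Real.exp_le_one_iff, Complex.re_ofReal_mul, Complex.sub_re,
      Complex.one_re]
    have := (Complex.re_le_norm (z j)).trans (hz j hj)
    exact mul_nonpos_of_nonneg_of_nonpos hp0 (by linarith)
  · rw [← nsmul_eq_mul]
    refine Finset.sum_le_card_nsmul _ _ _ fun j hj => ?_
    have h1 : ‖(p : ℂ) * (z j - 1)‖ ≤ 2 * p := by
      rw [norm_mul, Complex.norm_real, Real.norm_of_nonneg hp0, mul_comm]
      refine mul_le_mul_of_nonneg_right ((norm_sub_le _ _).trans ?_) hp0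
      have := hz j hj
      rw [norm_one]; linarith
    have h2 := Complex.norm_exp_sub_one_sub_id_le (h1.trans hp)
    rw [norm_sub_rev, ← sub_sub]
    exact h2.trans (pow_le_pow_left₀ (norm_nonneg _) h1 2)

theorem LocFinMeasure.measurable_integral {f : EuclideanSpace ℝ (Fin d) → ℝ} (hf : Continuous f)
    (hfc : HasCompactSupport f) : Measurable fun ν : LocFinMeasure d => ∫ x, f x ∂ν.1 := by
  have h1 : Continuous fun x => max (f x) 0 := by fun_prop
  have h2 : Continuous fun x => max (-f x) 0 := by fun_prop
  have hc1 : HasCompactSupport fun x => max (f x) 0 :=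
    hfc.comp_left (g := fun y => max y 0) (by simp)
  have hc2 : HasCompactSupport fun x => max (-f x) 0 :=
    hfc.comp_left (g := fun y => max (-y) 0) (by simp)
  have heq : ∀ ν : LocFinMeasure d,
      ∫ x, f x ∂ν.1 = (∫ x, max (f x) 0 ∂ν.1) - ∫ x, max (-f x) 0 ∂ν.1 := fun ν => by
    rw [← integral_sub (h1.integrable_of_hasCompactSupport hc1)
      (h2.integrable_of_hasCompactSupport hc2)]
    refine integral_congr_ae (Eventually.of_forall fun x => ?_)
    rcases le_total (f x) 0 with h | h <;> simp [h]
  simp_rw [heq]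
  exact ((LocFinMeasure.continuous_integral h1 hc1 fun x => le_max_right _ _).sub
    (LocFinMeasure.continuous_integral h2 hc2 fun x => le_max_right _ _)).measurable

theorem integral_latticeMeasure {f : EuclideanSpace ℝ (Fin d) → ℝ} {R : ℝ}
    (hR : ∀ x ∉ Metric.closedBall 0 R, f x = 0) (n : ℕ+) {x : (Fin d → ℤ) → ℝ}
    (hx : ∀ j, 0 ≤ x j) :
    ∫ y, f y ∂(latticeMeasure n x) =
      ∑ j ∈ cubeIndices d ((n : ℕ) * R), f (((n : ℕ) : ℝ)⁻¹ • latticePoint j) * x j := by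
  rw [latticeMeasure, integral_measureSum_of_support
    (Metric.isClosed_closedBall (x := 0) (ε := R)).measurableSet (cubeIndices d ((n : ℕ) * R))
    (fun j hj => ?_) hR fun j _ => ?_]
  · refine Finset.sum_congr rfl fun j _ => ?_
    rw [integral_smul_measure, integral_dirac, ENNReal.toReal_ofReal (hx j), smul_eq_mul, mul_comm]
  · rw [Measure.smul_apply, Measure.dirac_apply' _ Metric.isClosed_closedBall.measurableSet,
      Set.indicator_of_notMem fun h => hj (mem_cubeIndices_of_smul_latticePoint n.ne_zero h),
      smul_zero]
  · exact (integrable_dirac (by simp)).smul_measure ENNReal.ofReal_ne_top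

section OneField

variable {Ω : Type*} [MeasurableSpace Ω] {P : Measure Ω} {X : (Fin d → ℤ) → Ω → ℝ}

theorem nonneg_of_zero_one {x : ℝ} (h : x = 0 ∨ x = 1) : 0 ≤ x := by
  rcases h with h | h <;> simp [h]

theorem measurable_rescaledMeasure (n : ℕ+) (hmeas : ∀ j, Measurable (X j))
    (hval : ∀ j ω, X j ω = 0 ∨ X j ω = 1) : Measurable (rescaledMeasure n X) := by
  refine LocFinMeasure.measurable_of_integral fun f hf hfc hf0 => ?_
  obtain ⟨R, hR⟩ := hfc.isCompact.isBounded.subset_closedBall (0 : EuclideanSpace ℝ (Fin d))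
  have hR' : ∀ x ∉ Metric.closedBall 0 R, f x = 0 := fun x hx =>
    image_eq_zero_of_notMem_tsupport fun h => hx (hR h)
  simp_rw [rescaledMeasure, fun ω => integral_latticeMeasure hR' n
    (x := fun j => X j ω) fun j => nonneg_of_zero_one (hval j ω)]
  fun_prop

theorem IsWeaklyStationary.integral_eq (hstat : IsWeaklyStationary X P)
    (hmeas : ∀ j, Measurable (X j)) (hval : ∀ j ω, X j ω = 0 ∨ X j ω = 1) (j : Fin d → ℤ) :
    ∫ ω, X j ω ∂P = P.real {ω | X 0 ω = 1} := by
  have h := hstat.mean 0 j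
  rw [zero_add] at h
  have hset : MeasurableSet {ω | X 0 ω = 1} := hmeas 0 (measurableSet_singleton 1)
  rw [h, ← integral_indicator_one hset]
  refine integral_congr_ae (Eventually.of_forall fun ω => ?_)
  rcases hval 0 ω with h | h <;> simp [h, Set.indicator]

/-- The covariances of one variable with finitely many others are bounded by the full series. -/
theorem IsWeaklyStationary.sum_cov_le (hstat : IsWeaklyStationary X P)
    (hnn : ∀ j k, 0 ≤ cov[X j, X k; P])
    (hsum : Summable fun j : {j : Fin d → ℤ // j ≠ 0} => cov[X 0, X j; P])
    (K : Finset (Fin d → ℤ)) (k : Fin d → ℤ) :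
    ∑ j ∈ K.erase k, cov[X j, X k; P] ≤ ∑' j : {j : Fin d → ℤ // j ≠ 0}, cov[X 0, X j; P] := by
  set S : Set (Fin d → ℤ) := {j | j ≠ 0}
  have hsum' : Summable (S.indicator fun j => cov[X 0, X j; P]) :=
    summable_subtype_iff_indicator.1 hsum
  have htsum : ∑' j : {j : Fin d → ℤ // j ≠ 0}, cov[X 0, X j; P] =
      ∑' j, S.indicator (fun j => cov[X 0, X j; P]) j :=
    tsum_subtype S fun j => cov[X 0, X j; P]
  -- Stationarity moves the pair to the origin, and `j ↦ j - k` is injective, so the sum is a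
  -- partial sum of the nonnegative series.
  have hshift : ∀ j ∈ K.erase k, cov[X j, X k; P] =
      S.indicator (fun j => cov[X 0, X j; P]) (j - k) := by
    intro j hj
    rw [Set.indicator_of_mem (show j - k ∈ S from sub_ne_zero.2 (Finset.ne_of_mem_erase hj)),
      covariance_comm, ← hstat.covariance 0 (j - k) k, zero_add, sub_add_cancel]
  rw [htsum, Finset.sum_congr rfl hshift, ← Finset.sum_image (g := fun j => j - k)
    (f := S.indicator fun j => cov[X 0, X j; P]) (sub_left_injective.injOn)]
  exact hsum'.sum_le_tsum _ fun j _ => Set.indicator_nonneg (fun j _ => hnn 0 j) j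

/-- The two error terms are Newman's bound, with both coefficients at most `C`, and the replacement
of the Bernoulli product by an exponential. -/
theorem norm_charFunctional_rescaledMeasure_sub_le [IsProbabilityMeasure P] (n : ℕ+)
    (hmeas : ∀ j, Measurable (X j)) (hval : ∀ j ω, X j ω = 0 ∨ X j ω = 1) (hstat : IsWeaklyStationary X P)
    (hassoc : IsAssociated X P)
    (hsum : Summable fun j : {j : Fin d → ℤ // j ≠ 0} => cov[X 0, X j; P])
    (hp : 2 * P.real {ω | X 0 ω = 1} ≤ 1)
    {f : EuclideanSpace ℝ (Fin d) → ℝ} {C R : ℝ} (hC : ∀ x, |f x| ≤ C)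
    (hR : ∀ x ∉ Metric.closedBall 0 R, f x = 0) :
    ‖(∫ ω, Complex.exp (Complex.I * (∫ x, f x ∂(rescaledMeasure n X ω).1 : ℝ)) ∂P) -
      Complex.exp (P.real {ω | X 0 ω = 1} * ∑ j ∈ cubeIndices d ((n : ℕ) * R),
        (Complex.exp (Complex.I * f (((n : ℕ) : ℝ)⁻¹ • latticePoint j)) - 1))‖ ≤
    (cubeIndices d ((n : ℕ) * R)).card * (2 * C ^ 2 *
      (∑' j : {j : Fin d → ℤ // j ≠ 0}, cov[X 0, X j; P]) +
        (2 * P.real {ω | X 0 ω = 1}) ^ 2) := by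
  set K := cubeIndices d ((n : ℕ) * R)
  set p := P.real {ω | X 0 ω = 1} with hpdef
  set σ := ∑' j : {j : Fin d → ℤ // j ≠ 0}, cov[X 0, X j; P] with hσ
  let t : (Fin d → ℤ) → ℝ := fun j => f (((n : ℕ) : ℝ)⁻¹ • latticePoint j)
  have hnn := hassoc.cov_nonneg hmeas hval
  have hC0 : 0 ≤ C := (abs_nonneg _).trans (hC 0)
  have hint : ∀ ω, ∫ x, f x ∂(rescaledMeasure n X ω).1 = ∑ j ∈ K, t j * X j ω := fun ω =>
    integral_latticeMeasure hR n fun j => nonneg_of_zero_one (hval j ω)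
  simp_rw [hint]
  have h1 := hassoc.norm_charFun_sub_prod_le hmeas hval K t
  simp_rw [hstat.integral_eq hmeas hval, ← hpdef] at h1
  have h2 := norm_prod_sub_exp_le K (z := fun j => Complex.exp (Complex.I * t j))
    (fun j _ => (norm_exp_I_mul_ofReal _).le) (measureReal_nonneg (μ := P)) hp
  have h3 : ∑ k ∈ K, ∑ j ∈ K.erase k, |t k| * (|t j| * cov[X j, X k; P]) ≤
      K.card * (C ^ 2 * σ) := by
    rw [← nsmul_eq_mul]
    refine Finset.sum_le_card_nsmul _ _ _ fun k _ => ?_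
    calc ∑ j ∈ K.erase k, |t k| * (|t j| * cov[X j, X k; P])
        ≤ ∑ j ∈ K.erase k, C ^ 2 * cov[X j, X k; P] := by
          refine Finset.sum_le_sum fun j _ => ?_
          rw [← mul_assoc, sq]
          exact mul_le_mul_of_nonneg_right
            (mul_le_mul (hC _) (hC _) (abs_nonneg _) hC0) (hnn j k)
      _ ≤ C ^ 2 * σ := by
          rw [← Finset.mul_sum]
          exact mul_le_mul_of_nonneg_left (hstat.sum_cov_le hnn hsum K k) (by positivity)
  refine (norm_sub_le_norm_sub_add_norm_sub _ _ _).trans ((add_le_add h1 h2).trans ?_)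
  linarith

end OneField

theorem tendsto_charFunctional_rescaledMeasure (hd : 1 ≤ d) {Ω : ℕ+ → Type*}
    [∀ n, MeasurableSpace (Ω n)]
    (P : (n : ℕ+) → Measure (Ω n)) [∀ n, IsProbabilityMeasure (P n)]
    (X : (n : ℕ+) → (Fin d → ℤ) → Ω n → ℝ)
    (hmeas : ∀ n j, Measurable (X n j))
    (hval : ∀ n j ω, X n j ω = 0 ∨ X n j ω = 1)
    (hstat : ∀ n, IsWeaklyStationary (X n) (P n))
    (hassoc : ∀ n, IsAssociated (X n) (P n))
    (lam : ℝ≥0)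
    (hp : Tendsto (fun n : ℕ+ => (n : ℝ) ^ d * (P n).real {ω | X n 0 ω = 1}) atTop (𝓝 (lam : ℝ)))
    (hsum : ∀ᶠ n in atTop,
      Summable fun j : {j : Fin d → ℤ // j ≠ 0} => cov[X n 0, X n j; P n])
    (hsigma : Tendsto
      (fun n : ℕ+ => (n : ℝ) ^ d * ∑' j : {j : Fin d → ℤ // j ≠ 0}, cov[X n 0, X n j; P n])
      atTop (𝓝 0))
    {f : EuclideanSpace ℝ (Fin d) → ℝ} (hf : Continuous f) {C R : ℝ} (hC : ∀ x, |f x| ≤ C)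
    (hR0 : 0 ≤ R) (hR : ∀ x ∉ Metric.closedBall 0 R, f x = 0) :
    Tendsto (fun n => ∫ ω, Complex.exp
      (Complex.I * (∫ x, f x ∂(rescaledMeasure n (X n) ω).1 : ℝ)) ∂(P n)) atTop
      (𝓝 (Complex.exp (lam * ∫ x, (Complex.exp (Complex.I * f x) - 1)))) := by
  set p : ℕ+ → ℝ := fun n => (P n).real {ω | X n 0 ω = 1} with hpdef
  set σ : ℕ+ → ℝ := fun n => ∑' j : {j : Fin d → ℤ // j ≠ 0}, cov[X n 0, X n j; P n] with hσ
  have hcoe : Tendsto (fun n : ℕ+ => (n : ℕ)) atTop atTop := tendsto_PNat_val_atTop_atTop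
  -- Here `d ≥ 1` matters: `n^d → ∞` forces `p n → 0`, without which the quadratic error would
  -- survive.
  have hpow : Tendsto (fun n : ℕ+ => ((n : ℕ) : ℝ) ^ d) atTop atTop :=
    (tendsto_pow_atTop (by omega)).comp (tendsto_natCast_atTop_atTop.comp hcoe)
  have hne : ∀ n : ℕ+, ((n : ℕ) : ℝ) ^ d ≠ 0 := fun n => by
    have := n.ne_zero; positivity
  have hp0 : Tendsto p atTop (𝓝 0) := by
    refine (hp.div_atTop hpow).congr fun n => ?_
    rw [mul_div_cancel_left₀ _ (hne n)]
  have hg : Continuous fun x => Complex.exp (Complex.I * f x) - 1 := by fun_prop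
  have hriem := (tendsto_riemannSum hg (R := R) fun x hx => by simp [hR x hx]).comp hcoe
  have hmain : Tendsto (fun n : ℕ+ => Complex.exp (p n * ∑ j ∈ cubeIndices d ((n : ℕ) * R),
      (Complex.exp (Complex.I * f (((n : ℕ) : ℝ)⁻¹ • latticePoint j)) - 1))) atTop
      (𝓝 (Complex.exp (lam * ∫ x, (Complex.exp (Complex.I * f x) - 1)))) := by
    refine (Complex.continuous_exp.tendsto _).comp ?_
    have hp' : Tendsto (fun n : ℕ+ => (((n : ℕ) : ℝ) ^ d * p n : ℝ) : ℕ+ → ℂ) atTop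
        (𝓝 ((lam : ℝ) : ℂ)) := (Complex.continuous_ofReal.tendsto _).comp hp
    refine (hp'.mul hriem).congr fun n => ?_
    have : (((n : ℕ) : ℂ)) ^ d ≠ 0 := by exact_mod_cast hne n
    simp only [Function.comp_apply]
    push_cast
    field_simp
  have herr : Tendsto (fun n : ℕ+ => (2 * R + 2) ^ d * (2 * C ^ 2 * (((n : ℕ) : ℝ) ^ d * σ n) +
      4 * ((((n : ℕ) : ℝ) ^ d * p n) * p n))) atTop (𝓝 0) := by
    have := ((hsigma.const_mul (2 * C ^ 2)).add ((hp.mul hp0).const_mul 4)).const_mul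
      ((2 * R + 2) ^ d)
    simpa using this
  have hdiff : Tendsto (fun n => (∫ ω, Complex.exp
      (Complex.I * (∫ x, f x ∂(rescaledMeasure n (X n) ω).1 : ℝ)) ∂(P n)) -
      Complex.exp (p n * ∑ j ∈ cubeIndices d ((n : ℕ) * R),
      (Complex.exp (Complex.I * f (((n : ℕ) : ℝ)⁻¹ • latticePoint j)) - 1))) atTop (𝓝 0) := by
    refine squeeze_zero_norm' ?_ herr
    filter_upwards [hsum, hp0.eventually_le_const (show (0 : ℝ) < 1 / 2 by norm_num)] with n hn hpn
    refine (norm_charFunctional_rescaledMeasure_sub_le n (hmeas n) (hval n) (hstat n) (hassoc n) hn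
      (by simp only [hpdef] at hpn; linarith) hC hR).trans ?_
    have hσ0 : 0 ≤ σ n := tsum_nonneg fun j => (hassoc n).cov_nonneg (hmeas n) (hval n) 0 j
    refine (mul_le_mul_of_nonneg_right (card_cubeIndices_le d hR0 n.ne_zero)
      (by positivity)).trans (le_of_eq ?_)
    simp only [hpdef, hσ]
    ring
  simpa using hdiff.add hmain

end PoissonLimit


theorem theorem1 {d : ℕ} (hd : 1 ≤ d) {Ω : ℕ+ → Type*} [∀ n, MeasurableSpace (Ω n)]
    (P : (n : ℕ+) → Measure (Ω n)) [∀ n, IsProbabilityMeasure (P n)]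
    (X : (n : ℕ+) → (Fin d → ℤ) → Ω n → ℝ)
    (hmeas : ∀ n j, Measurable (X n j))
    (hval : ∀ n j ω, X n j ω = 0 ∨ X n j ω = 1)
    (hstat : ∀ n, IsWeaklyStationary (X n) (P n))
    (hassoc : ∀ n, IsAssociated (X n) (P n))
    (lam : ℝ≥0) (hlam : 0 < lam)
    (hp : Tendsto (fun n : ℕ+ => (n : ℝ) ^ d * (P n).real {ω | X n 0 ω = 1}) atTop (𝓝 (lam : ℝ)))
    (hsum : ∀ᶠ n in atTop,
      Summable fun j : {j : Fin d → ℤ // j ≠ 0} => cov[X n 0, X n j; P n])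
    (hsigma : Tendsto
      (fun n : ℕ+ => (n : ℝ) ^ d * ∑' j : {j : Fin d → ℤ // j ≠ 0}, cov[X n 0, X n j; P n])
      atTop (𝓝 0)) :
    ∃ Q : ProbabilityMeasure (LocFinMeasure d),
      IsPoissonProcessLaw lam (Q : Measure (LocFinMeasure d)) ∧
      TendstoInDistribution (fun n => rescaledMeasure n (X n)) atTop
        (id : LocFinMeasure d → LocFinMeasure d) P (Q : Measure (LocFinMeasure d)) := by

  have hm : ∀ n, Measurable (rescaledMeasure n (X n)) := fun n =>
    measurable_rescaledMeasure n (hmeas n) (hval n)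
  refine ⟨poissonProcessLaw d lam, isPoissonProcessLaw_poissonProcessLaw lam,
    ⟨fun n => (hm n).aemeasurable, aemeasurable_id,
      LocFinMeasure.tendsto_of_tendsto_charFunctional fun f hf hfc => ?_⟩⟩
  obtain ⟨C, hC⟩ := hfc.exists_bound_of_continuous hf
  obtain ⟨R, hR⟩ := hfc.isCompact.isBounded.subset_closedBall (0 : EuclideanSpace ℝ (Fin d))
  -- The maximum secures the nonnegative radius that the lattice point count needs.
  have hR' : ∀ x ∉ Metric.closedBall 0 (max R 0), f x = 0 := fun x hx =>
    image_eq_zero_of_notMem_tsupport fun h =>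
      hx (Metric.closedBall_subset_closedBall (le_max_left _ _) (hR h))
  have hfm := LocFinMeasure.measurable_integral hf hfc
  have hexp : Measurable fun ν : LocFinMeasure d =>
      Complex.exp (Complex.I * (∫ x, f x ∂ν.1 : ℝ)) :=
    Complex.measurable_exp.comp (hfm.complex_ofReal.const_mul _)
  simp only [ProbabilityMeasure.coe_mk, Measure.map_id]
  rw [charFunctional_poissonProcessLaw lam hf.measurable hC hR' hfm]
  simp_rw [fun n => integral_map (hm n).aemeasurable hexp.aestronglyMeasurable]
  exact tendsto_charFunctional_rescaledMeasure hd P X hmeas hval hstat hassoc lam hp hsum hsigma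
    hf hC (le_max_right _ _) hR'
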